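/- For an elliptic curve $E$ over a number field $K$ define its Faltings height (in Deligne's normalization) by $$h(E/K)=\frac{1}{12[K:\mathbb{Q}]}\Bigl(\log |N_{K/\mathbb{Q}}(\Delta_{E/K})|-\sum_{\sigma:K\hookrightarrow\mathbb{C}}\log\bigl(|\Delta(\tau_\sigma)|\,\mathrm{Im}(\tau_\sigma)^6\bigr)\Bigr)+\tfrac12\log\pi ,$$ where $\Delta_{E/K}$ is the minimal discriminant ideal of $E/K$, $\Delta(\tau)=(2\pi)^{12}q\prod_{n\ge1}(1-q^n)^{24}$ with $q=e^{2\pi i\tau}$, and for each embedding $\sigma$ the point $\tau_\sigma$ of the upper half-plane is chosen with $j(\tau_\sigma)=\sigma(j_E)$, $j$ being the modular $j$-function and $j_E$ the $j$-invariant of $E$. Let $$h_{\min}=-\frac12\log\left(\frac{1}{\sqrt3}\left(\frac{\Gamma(1/3)}{\Gamma(2/3)}\right)^3\right),$$ which by a theorem of Deligne is the minimum of $h(E/K)$ over all elliptic curves over number fields. Theorem. For every $\varepsilon>0$ there are a number field $K$ and an elliptic curve $E/K$ with $j$-invariant $0$ such that $$h_{\min}<h(E/K)<h_{\min}+\varepsilon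 .$$ -/

import Mathlib

noncomputable section

namespace FaltingsGap

open scoped UpperHalfPlane NumberField

open IsDedekindDomain NumberField

/-- The modular discriminant `Δ(τ) = (2π)¹² q ∏_{n ≥ 1} (1 - qⁿ)²⁴`, `q = exp(2πiτ)`.
Mathlib's `ModularForm.discriminant` is `q ∏_{n ≥ 1} (1 - qⁿ)²⁴`
(see `ModularForm.discriminant_eq_q_prod`). -/
def modularDelta (τ : ℍ) : ℂ :=
  (2 * Real.pi : ℂ) ^ 12 * ModularForm.discriminant τ

/-- The modular `j`-function `j(τ) = E₄(τ)³ / (q ∏_{n ≥ 1} (1 - qⁿ)²⁴) = 1/q + 744 + ⋯`. -/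
def modularJ (τ : ℍ) : ℂ :=
  ModularForm.E₄ τ ^ 3 / ModularForm.discriminant τ

/-- A chosen point `τ` of the upper half-plane with `j(τ) = z`. It exists for every `z : ℂ`, since
`j` is surjective; it is unique up to the action of `SL(2, ℤ)`. -/
def tauOfJ (z : ℂ) : ℍ :=
  Classical.epsilon fun τ : ℍ => modularJ τ = z

variable {K : Type*} [Field K] [NumberField K]

/-- The valuation `ord_v` of the discriminant of a Weierstrass equation of `E/K` that is minimal at
the finite place `v` (i.e. an equation over `K` with `v`-integral coefficients, isomorphic to `E`
over `K`, with `ord_v` of its discriminant as small as possible). -/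
def minimalDiscriminantExponent (E : WeierstrassCurve K) (v : HeightOneSpectrum (𝓞 K)) : ℕ :=
  (-WithZero.log (v.valuation K (E.minimal (v.valuation K).integer).Δ)).toNat

/-- The minimal discriminant of `E/K`, as an ideal of the ring of integers: the product over all
finite places of `v ^ ord_v(discriminant of a minimal equation at v)`. For an elliptic curve almost
all exponents vanish (`finite_minimalDiscriminantExponent_ne_zero` below). -/
def minimalDiscriminant (E : WeierstrassCurve K) : Ideal (𝓞 K) :=
  ∏ᶠ v : HeightOneSpectrum (𝓞 K), v.asIdeal ^ minimalDiscriminantExponent E v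

/-- The (unstable) Faltings height of the elliptic curve `E/K`, in Deligne's normalization. -/
def faltingsHeight (E : WeierstrassCurve K) [E.IsElliptic] : ℝ :=
  1 / (12 * (Module.finrank ℚ K : ℝ)) *
      (Real.log (Ideal.absNorm (minimalDiscriminant E) : ℝ) -
        ∑ σ : K →+* ℂ,
          Real.log (‖modularDelta (tauOfJ (σ E.j))‖ * (tauOfJ (σ E.j)).im ^ 6)) +
    1 / 2 * Real.log Real.pi

/-- Deligne's value for the minimum of the Faltings height on elliptic curves. -/
def hMin : ℝ :=
  -(1 / 2) * Real.log (1 / √3 * (Real.Gamma (1 / 3) / Real.Gamma (2 / 3)) ^ 3)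

/-- A `v`-integral equation with `v`-unit discriminant has minimal discriminant of valuation one. -/
theorem valuation_minimal_eq_one (E : WeierstrassCurve K) (v : HeightOneSpectrum (𝓞 K))
    (h₁ : v.valuation K E.a₁ ≤ 1) (h₂ : v.valuation K E.a₂ ≤ 1) (h₃ : v.valuation K E.a₃ ≤ 1)
    (h₄ : v.valuation K E.a₄ ≤ 1) (h₆ : v.valuation K E.a₆ ≤ 1) (hΔ : v.valuation K E.Δ = 1) :
    v.valuation K (E.minimal (v.valuation K).integer).Δ = 1 := by
  have hunit : ∀ r : (v.valuation K).integer,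
      (IsDiscreteValuationRing.maximalIdeal (v.valuation K).integer).valuation K
        (algebraMap (v.valuation K).integer K r) = 1 ↔ v.valuation K (r : K) = 1 := by
    intro r
    have h1 : v.valuation K (r : K) = 1 ↔ IsUnit r :=
      (Valuation.integer.integers (v.valuation K)).isUnit_iff_valuation_eq_one.symm
    rw [h1, ← not_iff_not, ← IsLocalRing.notMem_maximalIdeal, not_not]
    refine Iff.trans ?_ (HeightOneSpectrum.valuation_lt_one_iff_mem (K := K)
      (IsDiscreteValuationRing.maximalIdeal (v.valuation K).integer) r)
    exact ⟨fun h => lt_of_le_of_ne (HeightOneSpectrum.valuation_le_one _ r) h, fun h => h.ne⟩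
  have hint : WeierstrassCurve.IsIntegral (v.valuation K).integer E :=
    WeierstrassCurve.isIntegral_of_exists_lift _ ⟨⟨_, h₁⟩, rfl⟩ ⟨⟨_, h₂⟩, rfl⟩ ⟨⟨_, h₃⟩, rfl⟩
      ⟨⟨_, h₄⟩, rfl⟩ ⟨⟨_, h₆⟩, rfl⟩
  set M := E.minimal (v.valuation K).integer with hM
  obtain ⟨C, hC⟩ : ∃ C : WeierstrassCurve.VariableChange K, C • M = E :=
    ⟨(E.exists_isMinimal (v.valuation K).integer).choose⁻¹, by
      rw [hM, WeierstrassCurve.minimal, inv_smul_smul]⟩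
  have hmax := (WeierstrassCurve.IsMinimal.val_Δ_maximal
    (R := (v.valuation K).integer) (W := M)).2
  have hle := hmax (j := C) (by simpa only [hC] using hint)
  obtain ⟨r, hr⟩ := WeierstrassCurve.Δ_integral_of_isIntegral (v.valuation K).integer M
  have hE1 : (WeierstrassCurve.valuation_Δ_aux (v.valuation K).integer E :
      WithZero (Multiplicative ℤ)) = 1 := by
    rw [WeierstrassCurve.valuation_Δ_aux_eq_of_isIntegral]
    exact (hunit ⟨E.Δ, hΔ.le⟩).2 hΔ
  have hM1 : WeierstrassCurve.valuation_Δ_aux (v.valuation K).integer M = ⟨1, le_rfl⟩ := by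
    simp only [hC, one_smul] at hle
    have hE1' : WeierstrassCurve.valuation_Δ_aux (v.valuation K).integer E = ⟨1, le_rfl⟩ :=
      Subtype.ext hE1
    rw [hE1'] at hle
    exact le_antisymm (WeierstrassCurve.valuation_Δ_aux (v.valuation K).integer M).2
      (hle (WeierstrassCurve.valuation_Δ_aux (v.valuation K).integer M).2)
  have hM2 := WeierstrassCurve.valuation_Δ_aux_eq_of_isIntegral (v.valuation K).integer M
  rw [hM1, ← hr] at hM2
  rw [← hr]
  exact (hunit r).1 hM2.symm

/-- Only finitely many places contribute to the minimal discriminant of an elliptic curve. -/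
theorem finite_minimalDiscriminantExponent_ne_zero (E : WeierstrassCurve K) [E.IsElliptic] :
    {v : HeightOneSpectrum (𝓞 K) | minimalDiscriminantExponent E v ≠ 0}.Finite := by
  have key : ∀ x : K, {v : HeightOneSpectrum (𝓞 K) | ¬ v.valuation K x ≤ 1}.Finite :=
    fun x => by simpa [HeightOneSpectrum.Support] using HeightOneSpectrum.Support.finite (𝓞 K) x
  refine ((key E.a₁).union <| (key E.a₂).union <| (key E.a₃).union <| (key E.a₄).union <|
    (key E.a₆).union <| (key E.Δ).union (key E.Δ⁻¹)).subset fun v hv => ?_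
  by_contra hcon
  simp only [Set.mem_union, Set.mem_ofPred_eq, not_or, not_not] at hcon
  obtain ⟨h₁, h₂, h₃, h₄, h₆, hΔ, hΔ'⟩ := hcon
  refine hv ?_
  have hΔ1 : v.valuation K E.Δ = 1 := by
    refine le_antisymm hΔ ?_
    rw [map_inv₀] at hΔ'
    have h0 : v.valuation K E.Δ ≠ 0 := (Valuation.ne_zero_iff _).2 E.isUnit_Δ.ne_zero
    exact (inv_le_one₀ (zero_lt_iff.2 h0)).1 hΔ'
  simp [minimalDiscriminantExponent, valuation_minimal_eq_one E v h₁ h₂ h₃ h₄ h₆ hΔ1]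

end FaltingsGap

end

/-! ### Eisenstein series, `G₄`, `g₃` and the modular discriminant -/

namespace FaltingsGap

open scoped UpperHalfPlane
open Complex

/-! When `j = 0`, every embedding contributes the same archimedean term, and the average of these
terms combined with `½ log π` is exactly `hMin`. Hence the height is `hMin` plus `log N / (12 [K :
ℚ])`, with `N` the norm of the minimal discriminant (`faltingsHeight_of_j_eq_zero`). It remains to
find fields of growing degree over which `N` stays bounded but differs from 1.

Finite places: take `y² = x³ + 1`, with discriminant `-432 = -2⁴3³`, over a field of degree `12m +
1` containing `π` with `π ^ (12m + 1) = 6`. Rescaling by powers of `π` removes all but at most `π⁴`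
of the discriminant at each place (`valuation_pow_four_le_valuation_minimal_Δ`), and `π⁴` has norm
`6⁴` whatever `m` is. At a place where `π` is a uniformizer, the exponent is 3 or 4 modulo 12, so `N
≠ 1`.

Archimedean places: `j(τ) = 0` means that `G₄` of `ℤτ + ℤ` vanishes, so `℘'² = 4℘³ - g₃`. This
equation has an order-three symmetry, and uniqueness of its solutions makes the lattice stable under
cube roots of unity (`cubeRoot_mul_mem_lattice`). The lattice is then a multiple of the Eisenstein
integers. Since `|Δ| Im(τ)⁶` is unchanged by homothety, only `g₃` of the Eisenstein lattice is
needed. It comes from integrating the differential equation along the imaginary axis, which gives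
`B(1/6, 1/3)` (`beta_pow_six_of_ode`); Gamma identities then produce the constant in `hMin`. -/

/-- The pair of periods `(τ, 1)`. -/
def periodPairOfTau (τ : ℍ) : PeriodPair where
  ω₁ := τ
  ω₂ := 1
  indep := by
    rw [LinearIndependent.pair_iff]
    intro s t h
    have him := congrArg Complex.im h
    have hre := congrArg Complex.re h
    have hτ : (τ : ℂ).im ≠ 0 := τ.im_pos.ne'
    simp at him hre
    rcases him with h0 | h0
    · subst h0; simpa using hre
    · exact absurd h0 τ.im_pos.ne'

lemma periodPairOfTau_G (τ : ℍ) {k : ℕ} (hk : 3 ≤ k) :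
    (periodPairOfTau τ).G k = 2 * riemannZeta k * ModularForm.E hk τ := by
  have h1 : ModularForm.E hk τ = (1 / 2 : ℂ) * eisensteinSeries (N := 1) 0 k τ := rfl
  have h2 := tsum_eisSummand_eq_riemannZeta_mul_eisensteinSeries hk τ
  have h3 : (periodPairOfTau τ).G k = ∑' v : Fin 2 → ℤ, EisensteinSeries.eisSummand k v τ := by
    rw [PeriodPair.G, ← ((finTwoArrowEquiv ℤ).trans
      (periodPairOfTau τ).latticeEquivProd.symm.toEquiv).tsum_eq]
    refine tsum_congr fun v => ?_
    have : (((finTwoArrowEquiv ℤ).trans (periodPairOfTau τ).latticeEquivProd.symm.toEquiv) v : ℂ) =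
        v 0 * τ + v 1 * 1 :=
      (periodPairOfTau τ).latticeEquiv_symm_apply (v 0, v 1)
    rw [this]
    simp [EisensteinSeries.eisSummand]
  rw [h3, h2, h1]; ring

lemma riemannZeta_six : riemannZeta 6 = Real.pi ^ 6 / 945 := by
  have h := riemannZeta_two_mul_nat (k := 3) (by norm_num)
  norm_num at h
  rw [h]
  have : bernoulli 6 = 1 / 42 := by decide +kernel
  rw [this]
  norm_num [Nat.factorial]
  ring

lemma E₄_eq_zero_iff (τ : ℍ) : ModularForm.E₄ τ = 0 ↔ (periodPairOfTau τ).G 4 = 0 := by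
  rw [periodPairOfTau_G τ (k := 4) (by norm_num)]
  have : riemannZeta (4 : ℕ) ≠ 0 := by
    norm_num [riemannZeta_four, Real.pi_ne_zero]
  rw [mul_eq_zero, mul_eq_zero, or_iff_right (by simpa using this)]

lemma modularJ_eq_zero_iff (τ : ℍ) : modularJ τ = 0 ↔ (periodPairOfTau τ).G 4 = 0 := by
  rw [← E₄_eq_zero_iff, modularJ, div_eq_zero_iff]
  simp [ModularForm.discriminant_ne_zero]

/-- This is `Δ = g₂³ - 27 g₃²` with `g₂ = 0`, obtained from `E₄³ - E₆²` and the value of `ζ(6)`. -/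
lemma norm_modularDelta_of_G_four_eq_zero (τ : ℍ) (h : (periodPairOfTau τ).G 4 = 0) :
    ‖modularDelta τ‖ = 27 * ‖(periodPairOfTau τ).g₃‖ ^ 2 := by
  rw [← E₄_eq_zero_iff] at h
  have h6 := periodPairOfTau_G τ (k := 6) (by norm_num)
  norm_num at h6
  rw [riemannZeta_six] at h6
  have : modularDelta τ = - (27 * (periodPairOfTau τ).g₃ ^ 2) := by
    rw [modularDelta, ModularForm.discriminant_eq_E₄_cube_sub_E₆_sq, h, PeriodPair.g₃, h6]
    ring
  rw [this]; simp

/-! ### The value `B(1/6, 1/3)` and the equation `Q'² = 4 Q³ + c` -/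

/-- The twelfth power of `B(1/6, 1/3)` in terms of the quantity in `hMin`. -/
lemma beta_sixth_third_pow_twelve :
    ProbabilityTheory.beta (1 / 6) (1 / 3) ^ 12 = 2 ^ 14 *
      (Real.pi * (1 / √3 * (Real.Gamma (1 / 3) / Real.Gamma (2 / 3)) ^ 3)) ^ 6 := by
  -- Duplication at `1/6` eliminates `Γ(1/6)`, and reflection at `1/3` expresses `π` through `Γ(1/3)
  -- Γ(2/3)`. Both sides become monomials in these two values.
  have hdup := Real.Gamma_mul_Gamma_add_half (1 / 6)
  have hrefl := Real.Gamma_mul_Gamma_one_sub (1 / 3)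
  norm_num at hdup hrefl
  have hbeta : ProbabilityTheory.beta (1 / 6) (1 / 3) =
      Real.Gamma (1 / 6) * Real.Gamma (1 / 3) / √Real.pi := by
    rw [ProbabilityTheory.beta, ← Real.Gamma_one_half_eq]; norm_num
  have hpi : 0 < √Real.pi := Real.sqrt_pos.2 Real.pi_pos
  have h3 : (0 : ℝ) < √3 := by positivity
  have ha : 0 < Real.Gamma (1 / 3) := Real.Gamma_pos_of_pos (by norm_num)
  have hb : 0 < Real.Gamma (2 / 3) := Real.Gamma_pos_of_pos (by norm_num)
  set a := Real.Gamma (1 / 3)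
  set b := Real.Gamma (2 / 3)
  set r : ℝ := 2 ^ (2 / 3 : ℝ) with hr
  have hr3 : r ^ 3 = 4 := by
    rw [hr, ← Real.rpow_natCast, ← Real.rpow_mul (by norm_num)]; norm_num
  have hpi2 : Real.pi = a * b * √3 / 2 := by
    rw [hrefl, mul_one_div, Real.sin_pi_div_three]; field_simp
  have h1 : ProbabilityTheory.beta (1 / 6) (1 / 3) = r * a ^ 2 / b := by
    rw [hbeta]
    field_simp
    linear_combination hdup
  rw [h1, hpi2]
  have : (r * a ^ 2 / b) ^ 12 = (r ^ 3) ^ 4 * (a ^ 2 / b) ^ 12 := by ring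
  rw [this, hr3]
  field_simp
  ring

lemma beta_eq_setIntegral {a b : ℝ} (ha : 0 < a) (hb : 0 < b) :
    ProbabilityTheory.beta a b = ∫ x in Set.Ioo (0 : ℝ) 1, x ^ (a - 1) * (1 - x) ^ (b - 1) := by
  rw [ProbabilityTheory.beta_eq_betaIntegralReal a b ha hb, Complex.betaIntegral,
    intervalIntegral.integral_of_le zero_le_one, ← MeasureTheory.integral_Ioc_eq_integral_Ioo,
    ← Complex.ofReal_re (∫ x in Set.Ioc (0 : ℝ) 1, _), ← integral_complex_ofReal]
  congr 1
  refine MeasureTheory.setIntegral_congr_fun measurableSet_Ioc fun x hx => ?_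
  have h1 : 0 ≤ 1 - x := by linarith [hx.2]
  push_cast [Complex.ofReal_cpow hx.1.le, Complex.ofReal_cpow h1]
  rfl

/-- A decreasing solution of `Q'² = 4 Q³ + c` that runs from `∞` at `0` to `0` at `T` satisfies
`T = ∫₀^∞ dx / √(4 x³ + c)`, which is a value of the beta function. -/
lemma beta_pow_six_of_ode {Q Q' : ℝ → ℝ} {c T : ℝ} (hT : 0 < T) (hc : 0 < c)
    (hQ : ∀ t ∈ Set.Ioc 0 T, HasDerivAt Q (Q' t) t)
    (hode : ∀ t ∈ Set.Ioc 0 T, Q' t ^ 2 = 4 * Q t ^ 3 + c)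
    (hneg : ∀ t ∈ Set.Ioc 0 T, Q' t < 0) (hQT : Q T = 0)
    (hlim : Filter.Tendsto Q (nhdsWithin 0 (Set.Ioi 0)) Filter.atTop) :
    ProbabilityTheory.beta (1 / 6) (1 / 3) ^ 6 = 12 ^ 6 / 4 ^ 4 * c * T ^ 6 := by
  have hanti : StrictAntiOn Q (Set.Ioc 0 T) := by
    refine strictAntiOn_of_deriv_neg (convex_Ioc 0 T)
      (fun t ht => (hQ t ht).continuousAt.continuousWithinAt) fun t ht => ?_
    rw [interior_Ioc] at ht
    have ht' : t ∈ Set.Ioc 0 T := ⟨ht.1, ht.2.le⟩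
    rw [(hQ t ht').deriv]
    exact hneg t ht'
  have hTmem : T ∈ Set.Ioc 0 T := ⟨hT, le_rfl⟩
  have hpos : ∀ t ∈ Set.Ioo 0 T, 0 < Q t := fun t ht =>
    hQT ▸ hanti ⟨ht.1, ht.2.le⟩ hTmem ht.2
  have hnn : ∀ t ∈ Set.Ioc 0 T, 0 ≤ Q t := fun t ht =>
    hQT ▸ hanti.antitoneOn ht hTmem ht.2
  -- This substitution increases from 0 to 1 on `(0, T)`, and the equation for `Q'` turns `s^(-5/6)
  -- (1 - s)^(-2/3) ds` into a constant multiple `k dt`. The beta integral is therefore `k T`.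
  set s : ℝ → ℝ := fun t => c / (4 * Q t ^ 3 + c) with hs
  have hden : ∀ t ∈ Set.Ioc 0 T, 0 < 4 * Q t ^ 3 + c := fun t ht => by
    have := hnn t ht
    positivity
  have hsderiv : ∀ t ∈ Set.Ioc 0 T,
      HasDerivAt s (-(12 * c * Q t ^ 2 * Q' t) / (4 * Q t ^ 3 + c) ^ 2) t := fun t ht => by
    have h1 := (((hQ t ht).fun_pow 3).const_mul 4).add_const c
    refine (((hasDerivAt_const t c).fun_div h1 (hden t ht).ne')).congr_deriv ?_
    simp
    ring
  have hsmono : StrictMonoOn s (Set.Ioc 0 T) := fun x hx y hy hxy => by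
    have h1 := hanti hx hy hxy
    have h2 := pow_lt_pow_left₀ h1 (hnn y hy) (n := 3) (by norm_num)
    exact div_lt_div_of_pos_left hc (hden y hy) (by linarith)
  have hsT : s T = 1 := by simp [hs, hQT, hc.ne']
  have himage : s '' Set.Ioo 0 T = Set.Ioo 0 1 := by
    apply Set.Subset.antisymm
    · rintro _ ⟨t, ht, rfl⟩
      have ht' : t ∈ Set.Ioc 0 T := ⟨ht.1, ht.2.le⟩
      exact ⟨div_pos hc (hden t ht'), hsT ▸ hsmono ht' hTmem ht.2⟩
    · intro y hy
      have hslim : Filter.Tendsto s (nhdsWithin 0 (Set.Ioi 0)) (nhds 0) := by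
        refine Filter.Tendsto.const_div_atTop ?_ c
        refine Filter.tendsto_atTop_add_const_right _ c ?_
        exact ((Filter.tendsto_pow_atTop (by norm_num)).comp hlim).const_mul_atTop (by norm_num)
      have h1 := (hslim.eventually (gt_mem_nhds hy.1)).and
        (Ioo_mem_nhdsGT hT)
      obtain ⟨t₀, h2, h3⟩ := h1.exists
      have h4 := intermediate_value_Ioo (f := s) h3.2.le (fun t ht =>
        (hsderiv t ⟨h3.1.trans_le ht.1, ht.2⟩).continuousAt.continuousWithinAt)
      obtain ⟨t, ht, rfl⟩ := h4 ⟨h2, hsT ▸ hy.2⟩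
      exact ⟨t, ⟨h3.1.trans ht.1, ht.2⟩, rfl⟩
  have hsub : Set.Ioo 0 T ⊆ Set.Ioc 0 T := Set.Ioo_subset_Ioc_self
  set k : ℝ := 12 * c ^ (1 / 6 : ℝ) * 4 ^ (-(2 / 3) : ℝ) with hk
  have hint : ProbabilityTheory.beta (1 / 6) (1 / 3) = k * T := by
    rw [beta_eq_setIntegral (by norm_num) (by norm_num), ← himage,
      MeasureTheory.integral_image_eq_integral_abs_deriv_smul measurableSet_Ioo
        (fun t ht => (hsderiv t (hsub ht)).hasDerivWithinAt) (hsmono.mono hsub).injOn]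
    have : ∀ t ∈ Set.Ioo 0 T, |-(12 * c * Q t ^ 2 * Q' t) / (4 * Q t ^ 3 + c) ^ 2| •
        (s t ^ (1 / 6 - 1 : ℝ) * (1 - s t) ^ (1 / 3 - 1 : ℝ)) = k := by
      intro t ht
      have hq := hpos t ht
      have ht' := hsub ht
      obtain ⟨D, hD, hDpos⟩ : ∃ D, Q' t = -D ∧ 0 < D := ⟨-Q' t, by ring, by linarith [hneg t ht']⟩
      have hode' : 4 * Q t ^ 3 + c = D ^ 2 := by rw [← hode t ht', hD]; ring
      have hs1 : s t = c / D ^ 2 := by simp only [hs, hode']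
      have hs2 : 1 - s t = 4 * Q t ^ 3 / D ^ 2 := by
        rw [hs1]; field_simp; linarith
      have e1 : (c / D ^ 2) ^ (1 / 6 - 1 : ℝ) = c ^ (1 / 6 : ℝ) / c * D ^ (5 / 3 : ℝ) := by
        rw [Real.div_rpow hc.le (by positivity), Real.rpow_sub_one hc.ne', ← Real.rpow_natCast,
          ← Real.rpow_mul hDpos.le, div_eq_mul_inv _ (D ^ _), ← Real.rpow_neg hDpos.le]
        norm_num
      have e2 : (4 * Q t ^ 3 / D ^ 2) ^ (1 / 3 - 1 : ℝ) =
          4 ^ (-(2 / 3) : ℝ) / Q t ^ 2 * D ^ (4 / 3 : ℝ) := by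
        rw [Real.div_rpow (by positivity) (by positivity),
          Real.mul_rpow (by norm_num) (by positivity), ← Real.rpow_natCast (Q t) 3,
          ← Real.rpow_natCast D, ← Real.rpow_mul hDpos.le, ← Real.rpow_mul hq.le,
          div_eq_mul_inv _ (D ^ _), ← Real.rpow_neg hDpos.le, ← Real.rpow_natCast (Q t) 2,
          div_eq_mul_inv _ (Q t ^ _), ← Real.rpow_neg hq.le]
        norm_num
      have e3 : D ^ (5 / 3 : ℝ) * D ^ (4 / 3 : ℝ) = D ^ 3 := by
        rw [← Real.rpow_add hDpos, ← Real.rpow_natCast]; norm_num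
      have e4 : |-(12 * c * Q t ^ 2 * Q' t) / (4 * Q t ^ 3 + c) ^ 2| =
          12 * c * Q t ^ 2 / D ^ 3 := by
        rw [hode', hD, abs_of_nonneg (by ring_nf; positivity)]
        field_simp
      rw [hs2, hs1, e1, e2, e4, smul_eq_mul]
      calc _ = 12 * c ^ (1 / 6 : ℝ) * 4 ^ (-(2 / 3) : ℝ) *
            (D ^ (5 / 3 : ℝ) * D ^ (4 / 3 : ℝ) / D ^ 3) := by field_simp
        _ = k := by rw [e3, div_self (by positivity), mul_one]
    rw [MeasureTheory.setIntegral_congr_fun measurableSet_Ioo this]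
    simp [hT.le, mul_comm]
  have hk6 : k ^ 6 = 12 ^ 6 / 4 ^ 4 * c := by
    rw [hk, mul_pow, mul_pow, ← Real.rpow_natCast (c ^ _), ← Real.rpow_mul hc.le,
      ← Real.rpow_natCast (4 ^ _), ← Real.rpow_mul (by norm_num)]
    norm_num
    ring
  rw [hint, mul_pow, hk6]

end FaltingsGap
-- Lattices with `G₄ = 0` are stable under cube roots of unity
namespace FaltingsGap

open scoped UpperHalfPlane Topology PeriodPair
open Complex Filter

/-- The primitive cube root of unity `(-1 + √-3) / 2`. -/
noncomputable def cubeRoot : ℂ := ⟨-1 / 2, √3 / 2⟩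

lemma cubeRoot_sq : cubeRoot ^ 2 = -1 - cubeRoot := by
  have h : √3 * √3 = 3 := Real.mul_self_sqrt (by norm_num)
  apply Complex.ext <;> simp [cubeRoot, pow_two] <;> ring_nf
  rw [pow_two, h]; norm_num

lemma cubeRoot_pow_three : cubeRoot ^ 3 = 1 := by
  linear_combination (cubeRoot - 1) * cubeRoot_sq

lemma cubeRoot_ne_zero : cubeRoot ≠ 0 := fun h => by
  simpa [h] using cubeRoot_pow_three

lemma cubeRoot_ne_one : cubeRoot ≠ 1 := fun h => by
  have := congrArg Complex.re h
  norm_num [cubeRoot] at this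

variable {L : PeriodPair}

lemma eventually_notMem_lattice (L : PeriodPair) (x : ℂ) : ∀ᶠ z in 𝓝[≠] x, z ∉ L.lattice := by
  filter_upwards [mem_nhdsWithin_of_mem_nhds (L.compl_lattice_sdiff_singleton_mem_nhds x),
    self_mem_nhdsWithin] with z h1 h2 h3
  exact h1 ⟨h3, h2⟩

lemma tendsto_norm_weierstrassP (L : PeriodPair) {x : ℂ} (hx : x ∈ L.lattice) :
    Tendsto (fun z => ‖℘[L] z‖) (𝓝[≠] x) atTop := by
  rw [tendsto_norm_atTop_iff_cobounded]
  apply tendsto_cobounded_of_meromorphicOrderAt_neg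
  rw [L.order_weierstrassP x hx]
  exact WithTop.coe_lt_zero.2 (by norm_num)

lemma hasDerivAt_weierstrassP {z : ℂ} (hz : z ∉ L.lattice) :
    HasDerivAt ℘[L] (℘'[L] z) z := by
  rw [← L.deriv_weierstrassP]
  exact (L.analyticOnNhd_weierstrassP z hz).differentiableAt.hasDerivAt

lemma derivWeierstrassP_sq_of_G_four_eq_zero (hL : L.G 4 = 0) {z : ℂ} (hz : z ∉ L.lattice) :
    ℘'[L] z ^ 2 = 4 * ℘[L] z ^ 3 - L.g₃ := by
  rw [L.derivWeierstrassP_sq z hz, PeriodPair.g₂, hL]; ring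

lemma countable_lattice (L : PeriodPair) : (L.lattice : Set ℂ).Countable :=
  countable_of_Lindelof_of_discrete (X := L.lattice)

lemma isPreconnected_compl_of_countable {s : Set ℂ} (hs : s.Countable) : IsPreconnected sᶜ :=
  (hs.isPathConnected_compl_of_one_lt_rank
    (by rw [Complex.rank_real_complex]; norm_num)).isConnected.isPreconnected

/-- Differentiating `℘'² = 4℘³ - g₃` gives `℘' (℘'' - 6℘²) = 0`. If the second factor were nonzero
somewhere, `℘'` would vanish nearby, hence off the whole lattice by the identity theorem. Then `4℘³
= g₃`, against the pole at 0. -/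
lemma hasDerivAt_derivWeierstrassP (hL : L.G 4 = 0) {z : ℂ} (hz : z ∉ L.lattice) :
    HasDerivAt ℘'[L] (6 * ℘[L] z ^ 2) z := by
  have hopen : IsOpen (L.lattice : Set ℂ)ᶜ := L.isClosed_lattice.isOpen_compl
  have han := L.analyticOnNhd_derivWeierstrassP
  have hd : HasDerivAt ℘'[L] (deriv ℘'[L] z) z := (han z hz).differentiableAt.hasDerivAt
  suffices h : deriv ℘'[L] z - 6 * ℘[L] z ^ 2 = 0 by rwa [← sub_eq_zero.1 h]
  by_contra hne
  have hcont : ContinuousAt (fun z => deriv ℘'[L] z - 6 * ℘[L] z ^ 2) z :=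
    (han.deriv z hz).continuousAt.sub
      (continuousAt_const.mul ((L.analyticOnNhd_weierstrassP z hz).continuousAt.pow 2))
  have hzero : ∀ᶠ w in 𝓝 z, ℘'[L] w = 0 := by
    filter_upwards [hcont.eventually_ne hne, hopen.mem_nhds hz] with w hw hwL
    have h1 : HasDerivAt (fun w => ℘'[L] w ^ 2) (2 * ℘'[L] w * deriv ℘'[L] w) w := by
      simpa using (han w hwL).differentiableAt.hasDerivAt.fun_pow 2
    have h2 : HasDerivAt (fun w => 4 * ℘[L] w ^ 3 - L.g₃) (4 * (3 * ℘[L] w ^ 2 * ℘'[L] w)) w := by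
      simpa using (((hasDerivAt_weierstrassP hwL).fun_pow 3).const_mul 4).sub_const L.g₃
    have h3 : (fun w => ℘'[L] w ^ 2) =ᶠ[𝓝 w] fun w => 4 * ℘[L] w ^ 3 - L.g₃ := by
      filter_upwards [hopen.mem_nhds hwL] with v hv
      exact derivWeierstrassP_sq_of_G_four_eq_zero hL hv
    have h4 := (h1.congr_of_eventuallyEq h3.symm).unique h2
    have h5 : ℘'[L] w * (deriv ℘'[L] w - 6 * ℘[L] w ^ 2) = 0 := by linear_combination h4 / 2
    exact (mul_eq_zero.1 h5).resolve_right hw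
  have hall : Set.EqOn ℘'[L] 0 (L.lattice : Set ℂ)ᶜ :=
    han.eqOn_zero_of_preconnected_of_eventuallyEq_zero
      (isPreconnected_compl_of_countable (countable_lattice L)) hz hzero
  have hlim := tendsto_norm_weierstrassP L L.lattice.zero_mem
  have hlim3 : Tendsto (fun z => ‖℘[L] z‖ ^ 3) (𝓝[≠] 0) atTop :=
    (tendsto_pow_atTop (by norm_num)).comp hlim
  obtain ⟨w, hw, hwL⟩ := ((hlim3.eventually_gt_atTop (‖L.g₃‖ / 4)).and
    (eventually_notMem_lattice L 0)).exists
  have h1 := derivWeierstrassP_sq_of_G_four_eq_zero hL hwL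
  have h2 : ℘'[L] w = 0 := hall hwL
  have h3 : L.g₃ = 4 * ℘[L] w ^ 3 := by rw [h2] at h1; linear_combination h1
  rw [h3] at hw
  simp at hw

/-- Uniqueness for a linear equation, by orders of vanishing: a finite order of `D` at the zero `x`
would drop by one under differentiation, whereas multiplication by `A` cannot lower it. -/
lemma eventuallyEq_zero_of_deriv_eq_mul {D A : ℂ → ℂ} {x : ℂ} (hD : AnalyticAt ℂ D x)
    (hA : AnalyticAt ℂ A x) (h0 : D x = 0) (h : deriv D =ᶠ[𝓝 x] D * A) : D =ᶠ[𝓝 x] 0 := by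
  have h1 := hD.analyticOrderAt_deriv_add_one
  rw [analyticOrderAt_congr h, analyticOrderAt_mul hD hA, h0] at h1
  simp only [sub_zero] at h1
  refine analyticOrderAt_eq_top.1 ?_
  by_contra hne
  obtain ⟨n, hn⟩ := ENat.ne_top_iff_exists.1 hne
  rw [← hn] at h1
  cases hA' : analyticOrderAt A x with
  | top => simp [hA'] at h1
  | coe a => rw [hA'] at h1; norm_cast at h1; omega

/-- The conventions `℘ 0 = 0` and `0⁻¹ = 0` give `1/℘` exactly the value at the pole that makes it
analytic there. -/
lemma analyticAt_inv_weierstrassP (L : PeriodPair) : AnalyticAt ℂ (fun z => (℘[L] z)⁻¹) 0 := by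
  have h1 : (fun z => (℘[L] z)⁻¹) = fun z => z ^ 2 / (1 + z ^ 2 * L.weierstrassPExcept 0 z) := by
    funext z
    rcases eq_or_ne z 0 with rfl | hz
    · simp
    · have := L.weierstrassPExcept_add 0 z
      simp at this
      rw [← this, ← inv_div]
      congr 1
      field_simp
      ring
  rw [h1]
  have := L.analyticAt_weierstrassPExcept 0
  refine AnalyticAt.div (by fun_prop) (by fun_prop) (by simp)

lemma nhds_le_map_inv_weierstrassP (L : PeriodPair) :
    𝓝 0 ≤ map (fun z => (℘[L] z)⁻¹) (𝓝 0) := by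
  rcases (analyticAt_inv_weierstrassP L).eventually_constant_or_nhds_le_map_nhds with h | h
  · exfalso
    have hlim := tendsto_norm_weierstrassP L L.lattice.zero_mem
    obtain ⟨w, hw, hw'⟩ := ((hlim.eventually_gt_atTop 0).and
      (h.filter_mono nhdsWithin_le_nhds)).exists
    simp at hw hw'
    exact hw hw'
  · simpa using h

/-- Supplies matching initial data for two solutions of the same equation. As `1/℘` is open at 0, it
takes the value `cubeRoot / ℘ w` for `w` near 0. The two derivatives then have equal squares, and
replacing `z` by `-z` corrects the sign. -/
lemma exists_weierstrassP_eq_cubeRoot_mul (hL : L.G 4 = 0) :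
    ∃ z ∉ L.lattice, ∃ w ∉ L.lattice, ℘[L] z = cubeRoot ^ 2 * ℘[L] w ∧ ℘'[L] z = ℘'[L] w ∧
      ℘'[L] z ≠ 0 := by
  set u : ℂ → ℂ := fun z => (℘[L] z)⁻¹ with hu
  have hN : {z : ℂ | z ∈ L.lattice → z = 0} ∈ 𝓝 (0 : ℂ) := by
    filter_upwards [L.compl_lattice_sdiff_singleton_mem_nhds 0] with z hz hzL
    by_contra hne
    exact hz ⟨hzL, hne⟩
  have himg : u '' {z : ℂ | z ∈ L.lattice → z = 0} ∈ 𝓝 (0 : ℂ) :=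
    nhds_le_map_inv_weierstrassP L (image_mem_map hN)
  have hucont : Tendsto u (𝓝[≠] 0) (𝓝 0) := by
    have := (analyticAt_inv_weierstrassP L).continuousAt.tendsto
    simp only [PeriodPair.weierstrassP_zero, inv_zero] at this
    exact this.mono_left nhdsWithin_le_nhds
  have h1 : Tendsto (fun w => cubeRoot * u w) (𝓝[≠] 0) (𝓝 0) := by
    simpa using hucont.const_mul cubeRoot
  have h2 : Tendsto (fun w => u w ^ 3 * L.g₃) (𝓝[≠] 0) (𝓝 0) := by
    simpa using (hucont.pow 3).mul_const L.g₃
  obtain ⟨w, ⟨⟨hw1, hw2⟩, hw3⟩, hw4⟩ := (((h1.eventually himg).and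
    -- Since `℘'² = 4℘³ - g₃`, avoiding `g₃ / ℘³ = 4` ensures `℘' w ≠ 0`.
    (h2.eventually_ne (show (0 : ℂ) ≠ 4 by norm_num))).and (eventually_notMem_lattice L 0)).and
    ((tendsto_norm_weierstrassP L L.lattice.zero_mem).eventually_gt_atTop 0) |>.exists
  obtain ⟨z, hz1, hz2⟩ := hw1
  have hw5 : ℘[L] w ≠ 0 := norm_pos_iff.1 hw4
  have hzne : ℘[L] z ≠ 0 := fun h => by
    simp [hu, h, cubeRoot_ne_zero, hw5] at hz2
  have hzL : z ∉ L.lattice := fun h => hzne (by rw [hz1 h]; simp)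
  have hzw : ℘[L] z = cubeRoot ^ 2 * ℘[L] w := by
    simp only [hu] at hz2
    have := cubeRoot_ne_zero
    field_simp at hz2
    linear_combination -cubeRoot ^ 2 * hz2 - ℘[L] z * cubeRoot_pow_three
  have hsqz := derivWeierstrassP_sq_of_G_four_eq_zero hL hzL
  have hsqw := derivWeierstrassP_sq_of_G_four_eq_zero hL hw3
  have hsq : ℘'[L] z ^ 2 = ℘'[L] w ^ 2 := by
    rw [hsqz, hsqw, hzw]
    linear_combination 4 * ℘[L] w ^ 3 * (cubeRoot ^ 3 + 1) * cubeRoot_pow_three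
  have hwne : ℘'[L] w ≠ 0 := fun h => by
    apply hw2
    rw [h] at hsqw
    simp only [hu]
    field_simp
    linear_combination hsqw
  rcases sq_eq_sq_iff_eq_or_eq_neg.1 hsq with h | h
  · exact ⟨z, hzL, w, hw3, hzw, h, h ▸ hwne⟩
  · refine ⟨-z, by simpa using hzL, w, hw3, by rw [L.weierstrassP_neg, hzw], ?_, ?_⟩ <;>
    rw [L.derivWeierstrassP_neg, h, neg_neg]
    exact hwne

/-- The functions `p` and `f` below solve the same equation `y'² = 4y³ - g₃` with the same initial
value and derivative, so they coincide, and so do their poles. -/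
lemma cubeRoot_mul_mem_lattice (hL : L.G 4 = 0) {x : ℂ} (hx : x ∈ L.lattice) :
    cubeRoot * x ∈ L.lattice := by
  obtain ⟨z₁, hz₁, w₀, hw₀, h0, h1, h2⟩ := exists_weierstrassP_eq_cubeRoot_mul hL
  set p : ℂ → ℂ := fun z => ℘[L] (z₁ + z) with hp
  set f : ℂ → ℂ := fun z => cubeRoot ^ 2 * ℘[L] (w₀ + cubeRoot * z) with hf
  have hpan : ∀ z, z₁ + z ∉ L.lattice → AnalyticAt ℂ p z := fun z hz =>
    (L.analyticOnNhd_weierstrassP _ hz).comp_of_eq (by fun_prop) rfl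
  have hfan : ∀ z, w₀ + cubeRoot * z ∉ L.lattice → AnalyticAt ℂ f z := fun z hz =>
    analyticAt_const.mul ((L.analyticOnNhd_weierstrassP _ hz).comp_of_eq (by fun_prop) rfl)
  have hpd : ∀ z, z₁ + z ∉ L.lattice → HasDerivAt p (℘'[L] (z₁ + z)) z := fun z hz => by
    simpa using (hasDerivAt_weierstrassP hz).comp_const_add z₁ z
  have hfd : ∀ z, w₀ + cubeRoot * z ∉ L.lattice → HasDerivAt f (℘'[L] (w₀ + cubeRoot * z)) z :=
    fun z hz => by
      have h3 : HasDerivAt (fun z => w₀ + cubeRoot * z) cubeRoot z := by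
        simpa using ((hasDerivAt_id z).const_mul cubeRoot).const_add w₀
      refine (((hasDerivAt_weierstrassP hz).comp z h3).const_mul (cubeRoot ^ 2)).congr_deriv ?_
      linear_combination ℘'[L] (w₀ + cubeRoot * z) * cubeRoot_pow_three
  set S : Set ℂ := {z | z₁ + z ∈ L.lattice} ∪ {z | w₀ + cubeRoot * z ∈ L.lattice} with hS
  have hScount : S.Countable := by
    refine ((countable_lattice L).preimage (f := fun z => z₁ + z) (add_right_injective z₁)).union
      ((countable_lattice L).preimage (f := fun z => w₀ + cubeRoot * z) ?_)
    exact (add_right_injective w₀).comp (mul_right_injective₀ cubeRoot_ne_zero)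
  have hSclosed : IsClosed S :=
    (L.isClosed_lattice.preimage (f := fun z => z₁ + z) (by fun_prop)).union
      (L.isClosed_lattice.preimage (f := fun z => w₀ + cubeRoot * z) (by fun_prop))
  have h0S : (0 : ℂ) ∈ Sᶜ := by simp [hS, hz₁, hw₀]
  have hnear : p - f =ᶠ[𝓝 0] 0 := by
    have hder : ∀ z ∈ Sᶜ, deriv (p - f) z = ℘'[L] (z₁ + z) - ℘'[L] (w₀ + cubeRoot * z) :=
      fun z hz => by
        simp only [hS, Set.mem_compl_iff, Set.mem_union, not_or] at hz
        exact ((hpd z hz.1).sub (hfd z hz.2)).deriv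
    have ha1 : AnalyticAt ℂ p 0 := hpan 0 (by simpa using hz₁)
    have ha2 : AnalyticAt ℂ f 0 := hfan 0 (by simpa using hw₀)
    have ha3 : AnalyticAt ℂ (fun z => ℘'[L] (z₁ + z)) 0 :=
      (L.analyticOnNhd_derivWeierstrassP _ hz₁).comp_of_eq (by fun_prop) (by simp)
    have ha4 : AnalyticAt ℂ (fun z => ℘'[L] (w₀ + cubeRoot * z)) 0 :=
      (L.analyticOnNhd_derivWeierstrassP _ hw₀).comp_of_eq (by fun_prop) (by simp)
    have hne : ℘'[L] (z₁ + 0) + ℘'[L] (w₀ + cubeRoot * 0) ≠ 0 := by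
      rw [add_zero, mul_zero, add_zero, ← h1, ← two_mul]
      exact mul_ne_zero two_ne_zero h2
    -- Subtracting the two equations gives `(p' - f')(p' + f') = 4(p³ - f³)`. Division by `p' + f'`
    -- is allowed near 0 because the common initial derivative is nonzero.
    refine eventuallyEq_zero_of_deriv_eq_mul (A := fun z => 4 * (p z ^ 2 + p z * f z + f z ^ 2) /
      (℘'[L] (z₁ + z) + ℘'[L] (w₀ + cubeRoot * z))) (ha1.sub ha2)
      (AnalyticAt.fun_div (by fun_prop) (by fun_prop) hne) (by simp [hp, hf, h0]) ?_
    filter_upwards [hSclosed.isOpen_compl.mem_nhds h0S,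
      (ha3.add ha4).continuousAt.eventually_ne hne] with z hz hz'
    rw [hder z hz]
    simp only [hS, Set.mem_compl_iff, Set.mem_union, not_or] at hz
    have e1 := derivWeierstrassP_sq_of_G_four_eq_zero hL hz.1
    have e2 := derivWeierstrassP_sq_of_G_four_eq_zero hL hz.2
    have e3 : f z ^ 3 = ℘[L] (w₀ + cubeRoot * z) ^ 3 := by
      simp only [hf]
      linear_combination ℘[L] (w₀ + cubeRoot * z) ^ 3 * (cubeRoot ^ 3 + 1) * cubeRoot_pow_three
    rw [← e3] at e2
    replace e1 : ℘'[L] (z₁ + z) ^ 2 = 4 * p z ^ 3 - L.g₃ := e1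
    simp only [Pi.mul_apply, Pi.sub_apply]
    rw [mul_div_assoc', eq_div_iff (by exact hz')]
    linear_combination e1 - e2
  have hall : Set.EqOn (p - f) 0 Sᶜ := by
    have han : AnalyticOnNhd ℂ (p - f) Sᶜ := fun z hz => ?_
    · exact han.eqOn_zero_of_preconnected_of_eventuallyEq_zero
        (isPreconnected_compl_of_countable hScount) h0S hnear
    simp only [hS, Set.mem_compl_iff, Set.mem_union, not_or] at hz
    exact (hpan z hz.1).sub (hfan z hz.2)
  -- At a pole of `p`, the function `f` cannot be continuous, since the two agree on a punctured
  -- neighbourhood.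
  have key : ∀ z, z₁ + z ∈ L.lattice → w₀ + cubeRoot * z ∈ L.lattice := by
    intro z hz
    by_contra hcon
    have hlim : Tendsto (fun v => ‖p v‖) (𝓝[≠] z) atTop := by
      refine (tendsto_norm_weierstrassP L hz).comp (tendsto_nhdsWithin_iff.2 ⟨?_, ?_⟩)
      · exact ((continuous_const.add continuous_id).tendsto z).mono_left nhdsWithin_le_nhds
      · filter_upwards [self_mem_nhdsWithin] with v hv
        simpa using hv
    have hfc : Tendsto (fun v => ‖f v‖) (𝓝[≠] z) (𝓝 ‖f z‖) :=
      (hfan z hcon).continuousAt.norm.tendsto.mono_left nhdsWithin_le_nhds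
    have heq : (fun v => ‖p v‖) =ᶠ[𝓝[≠] z] fun v => ‖f v‖ := by
      have hev1 : ∀ᶠ v in 𝓝[≠] z, w₀ + cubeRoot * v ∉ L.lattice := by
        refine mem_nhdsWithin_of_mem_nhds ?_
        exact (L.isClosed_lattice.preimage (f := fun z => w₀ + cubeRoot * z)
          (by fun_prop)).isOpen_compl.mem_nhds hcon
      have hev2 : ∀ᶠ v in 𝓝[≠] z, z₁ + v ∉ L.lattice := by
        refine Tendsto.eventually (f := fun v => z₁ + v) (tendsto_nhdsWithin_iff.2 ⟨?_, ?_⟩)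
          (eventually_notMem_lattice L (z₁ + z))
        · exact ((continuous_const.add continuous_id).tendsto z).mono_left nhdsWithin_le_nhds
        · filter_upwards [self_mem_nhdsWithin] with v hv
          simpa using hv
      filter_upwards [hev1, hev2] with v hv1 hv2
      have : (p - f) v = 0 := hall (by simp [hS, hv1, hv2])
      rw [sub_eq_zero.1 this]
    exact not_tendsto_nhds_of_tendsto_atTop (hlim.congr' heq) _ hfc
  have k0 := key (-z₁) (by simp)
  have kx := key (x - z₁) (by simpa using hx)
  have := L.lattice.sub_mem kx k0
  convert this using 1
  ring

end FaltingsGap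
-- Reduction to the lattice of Eisenstein integers
namespace FaltingsGap

open scoped UpperHalfPlane Topology PeriodPair
open Complex Filter

variable {L : PeriodPair}

/-- The primitive cube root of unity as a point of the upper half-plane. -/
noncomputable def cubeRootPoint : ℍ := ⟨cubeRoot, by simp [cubeRoot]⟩

/-- A pair of periods that spans the lattice of Eisenstein integers. -/
noncomputable def eisensteinPair : PeriodPair := periodPairOfTau cubeRootPoint

lemma mem_eisenstein_lattice {x : ℂ} :
    x ∈ eisensteinPair.lattice ↔ ∃ m n : ℤ, m * cubeRoot + n = x := by
  rw [PeriodPair.mem_lattice]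
  simp [eisensteinPair, periodPairOfTau, cubeRootPoint]

lemma cubeRoot_mul_mem_eisenstein {x : ℂ} (hx : x ∈ eisensteinPair.lattice) :
    cubeRoot * x ∈ eisensteinPair.lattice := by
  rw [mem_eisenstein_lattice] at hx ⊢
  obtain ⟨m, n, rfl⟩ := hx
  refine ⟨n - m, -m, ?_⟩
  push_cast
  linear_combination -(m : ℂ) * cubeRoot_sq

/-- Euclidean division: rounding both coordinates leaves a remainder of squared norm at most `1/4 +
3/16`. -/
lemma exists_eisenstein_norm_sub_lt_one (z : ℂ) :
    ∃ a ∈ eisensteinPair.lattice, ‖z - a‖ < 1 := by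
  have h3 : √3 * √3 = 3 := Real.mul_self_sqrt (by norm_num)
  have h3' : 0 < √3 := by positivity
  set m : ℤ := round (z.im / (√3 / 2)) with hm
  set n : ℤ := round (z.re + m / 2) with hn
  refine ⟨m * cubeRoot + n, mem_eisenstein_lattice.2 ⟨m, n, rfl⟩, ?_⟩
  have h1 := abs_sub_round (z.im / (√3 / 2))
  have h2 := abs_sub_round (z.re + m / 2)
  rw [← hm, abs_le] at h1
  rw [← hn, abs_le] at h2
  rw [← sq_lt_one_iff₀ (norm_nonneg _), Complex.sq_norm, Complex.normSq_apply]
  simp only [cubeRoot, Complex.sub_re, Complex.add_re, Complex.mul_re, Complex.intCast_re,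
    Complex.intCast_im, Complex.sub_im, Complex.add_im, Complex.mul_im]
  set y := z.im / (√3 / 2) - m with hy
  set x := z.re + m / 2 - n with hx
  have e1 : z.re - (m * (-1 / 2) - 0 * (√3 / 2) + n) = x := by rw [hx]; ring
  have e2 : z.im - (m * (√3 / 2) + 0 * (-1 / 2) + 0) = √3 / 2 * y := by
    rw [hy]; field_simp; ring
  rw [e1, e2, show x * x + √3 / 2 * y * (√3 / 2 * y) = x ^ 2 + √3 * √3 / 4 * y ^ 2 by ring, h3]
  have hx2 : x ^ 2 ≤ (1 / 2) ^ 2 := sq_le_sq' h2.1 h2.2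
  have hy2 : y ^ 2 ≤ (1 / 2) ^ 2 := sq_le_sq' h1.1 h1.2
  linarith

lemma exists_norm_minimal (L : PeriodPair) :
    ∃ l ∈ L.lattice, l ≠ 0 ∧ ∀ x ∈ L.lattice, x ≠ 0 → ‖l‖ ≤ ‖x‖ := by
  have hω : L.ω₁ ≠ 0 := by simpa using L.indep.ne_zero 0
  set s : Set ℂ := Metric.closedBall 0 ‖L.ω₁‖ ∩ L.lattice with hs
  have hfin : s.Finite :=
    Metric.finite_isBounded_inter_isClosed
      ⟨inferInstanceAs (DiscreteTopology L.lattice)⟩ Metric.isBounded_closedBall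
      L.isClosed_lattice
  obtain ⟨l, hl, hmin⟩ := Set.exists_min_image (s \ {0}) (fun x => ‖x‖) (hfin.subset Set.sdiff_subset)
    ⟨L.ω₁, by simp [hs, L.ω₁_mem_lattice, hω]⟩
  refine ⟨l, hl.1.2, hl.2, fun x hx hx0 => ?_⟩
  rcases le_total ‖x‖ ‖L.ω₁‖ with h | h
  · exact hmin x ⟨⟨by simpa using h, hx⟩, hx0⟩
  · exact le_trans (by simpa using hl.1.1) h

/-- A lattice that is stable under the cube roots of unity is a multiple of the Eisenstein
integers. -/
lemma exists_mem_lattice_iff_mem_eisenstein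
    (hL : ∀ x ∈ L.lattice, cubeRoot * x ∈ L.lattice) :
    ∃ l : ℂ, l ≠ 0 ∧ ∀ x, l * x ∈ L.lattice ↔ x ∈ eisensteinPair.lattice := by
  -- A shortest nonzero vector generates: a nonzero remainder on division by it would be shorter.
  obtain ⟨l, hlL, hl0, hmin⟩ := exists_norm_minimal L
  have hmem : ∀ x ∈ eisensteinPair.lattice, l * x ∈ L.lattice := by
    intro x hx
    obtain ⟨m, n, rfl⟩ := mem_eisenstein_lattice.1 hx
    have h1 := L.lattice.add_mem (L.lattice.smul_mem m (hL l hlL)) (L.lattice.smul_mem n hlL)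
    convert h1 using 1
    simp
    ring
  refine ⟨l, hl0, fun x => ⟨fun hx => ?_, hmem x⟩⟩
  obtain ⟨a, ha, hxa⟩ := exists_eisenstein_norm_sub_lt_one x
  have h1 : l * (x - a) ∈ L.lattice := by
    rw [mul_sub]; exact L.lattice.sub_mem hx (hmem a ha)
  by_cases h0 : l * (x - a) = 0
  · rw [mul_eq_zero, or_iff_right hl0, sub_eq_zero] at h0
    rwa [h0]
  · have h2 := hmin _ h1 h0
    rw [norm_mul] at h2
    have := norm_pos_iff.2 hl0
    nlinarith

lemma G_eq_of_mem_lattice_iff {L' : PeriodPair} {l : ℂ} (hl : l ≠ 0)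
    (h : ∀ x, l * x ∈ L.lattice ↔ x ∈ L'.lattice) (n : ℕ) : L.G n = (l ^ n)⁻¹ * L'.G n := by
  let e : L'.lattice ≃ L.lattice :=
    { toFun := fun x => ⟨l * x, (h x).2 x.2⟩
      invFun := fun y => ⟨l⁻¹ * y, (h _).1 (by rw [mul_inv_cancel_left₀ hl]; exact y.2)⟩
      left_inv := fun x => by simp [hl]
      right_inv := fun y => by simp [hl] }
  rw [PeriodPair.G, ← e.tsum_eq, PeriodPair.G, ← tsum_mul_left]
  refine tsum_congr fun x => ?_
  simp [e, mul_pow, mul_comm]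

/-- Both sides are covolumes of one lattice, written as `Im (a * conj b)` for a basis `a, b`. The
two base changes have integer determinants with product 1, and positivity makes them equal to 1. -/
lemma im_eq_of_mem_lattice_iff {τ : ℍ} {l : ℂ} (hl0 : l ≠ 0)
    (h : ∀ x, l * x ∈ (periodPairOfTau τ).lattice ↔ x ∈ eisensteinPair.lattice) :
    τ.im = ‖l‖ ^ 2 * (√3 / 2) := by
  have h1 : l * 1 ∈ (periodPairOfTau τ).lattice :=
    (h 1).2 (mem_eisenstein_lattice.2 ⟨0, 1, by simp⟩)
  have h2 : l * cubeRoot ∈ (periodPairOfTau τ).lattice :=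
    (h cubeRoot).2 (mem_eisenstein_lattice.2 ⟨1, 0, by simp⟩)
  have h3 : l⁻¹ * τ ∈ eisensteinPair.lattice := by
    rw [← h, mul_inv_cancel_left₀ hl0]
    exact (periodPairOfTau τ).ω₁_mem_lattice
  have h4 : l⁻¹ * 1 ∈ eisensteinPair.lattice := by
    rw [← h, mul_inv_cancel_left₀ hl0]
    exact (periodPairOfTau τ).ω₂_mem_lattice
  obtain ⟨a, b, hab⟩ := PeriodPair.mem_lattice.1 h1
  obtain ⟨c, d, hcd⟩ := PeriodPair.mem_lattice.1 h2
  obtain ⟨p, q, hpq⟩ := mem_eisenstein_lattice.1 h3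
  obtain ⟨r, s, hrs⟩ := mem_eisenstein_lattice.1 h4
  replace hab : a * (τ : ℂ) + b * 1 = l * 1 := hab
  replace hcd : c * (τ : ℂ) + d * 1 = l * cubeRoot := hcd
  have e1 : (τ : ℂ) = l * (p * cubeRoot + q) := by rw [hpq, mul_inv_cancel_left₀ hl0]
  have e2 : (1 : ℂ) = l * (r * cubeRoot + s) := by rw [hrs, mul_inv_cancel_left₀ hl0]
  have hnorm : ‖l‖ ^ 2 = l.re * l.re + l.im * l.im := by
    rw [Complex.sq_norm, Complex.normSq_apply]
  have him1 : τ.im = ‖l‖ ^ 2 * (√3 / 2) * ((p * s - q * r : ℤ) : ℝ) := by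
    have : τ.im = ((τ : ℂ) * (starRingEnd ℂ) 1).im := by simp
    rw [this, e1, e2, hnorm]
    simp [cubeRoot]
    ring
  have him2 : ‖l‖ ^ 2 * (√3 / 2) = τ.im * ((b * c - a * d : ℤ) : ℝ) := by
    have : ‖l‖ ^ 2 * (√3 / 2) = ((l * cubeRoot) * (starRingEnd ℂ) (l * 1)).im := by
      rw [hnorm]; simp [cubeRoot]; ring
    rw [this, ← hcd, ← hab]
    simp
    ring
  have hpos := τ.im_pos
  have hpos' : 0 < ‖l‖ ^ 2 * (√3 / 2) := by
    have := norm_pos_iff.2 hl0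
    positivity
  set u : ℤ := p * s - q * r
  set v : ℤ := b * c - a * d
  have hu : 0 < u := by
    have := pos_of_mul_pos_right (him1 ▸ hpos) hpos'.le
    exact_mod_cast this
  have huv : (v : ℝ) * u = 1 := by
    have h5 : τ.im * ((v : ℝ) * u) = τ.im * 1 := by
      rw [← mul_assoc, ← him2, ← him1, mul_one]
    exact mul_left_cancel₀ hpos.ne' h5
  have huv' : v * u = 1 := by exact_mod_cast huv
  have hu1 : u = 1 := Int.eq_one_of_mul_eq_one_left hu.le huv'
  rw [him1, hu1]; simp

/-! ### Symmetries of `℘` on the Eisenstein lattice and the value of `g₃` -/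

lemma conj_mem_eisenstein {x : ℂ} (hx : x ∈ eisensteinPair.lattice) :
    (starRingEnd ℂ) x ∈ eisensteinPair.lattice := by
  rw [mem_eisenstein_lattice] at hx ⊢
  obtain ⟨m, n, rfl⟩ := hx
  refine ⟨-m, n - m, ?_⟩
  apply Complex.ext <;> simp [cubeRoot]
  ring

/-- Complex conjugation on the lattice of Eisenstein integers. -/
noncomputable def conjEquivEisenstein : eisensteinPair.lattice ≃ eisensteinPair.lattice where
  toFun x := ⟨(starRingEnd ℂ) x, conj_mem_eisenstein x.2⟩
  invFun x := ⟨(starRingEnd ℂ) x, conj_mem_eisenstein x.2⟩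
  left_inv x := by simp
  right_inv x := by simp

/-- Multiplication by the cube root of unity on the lattice of Eisenstein integers. -/
noncomputable def cubeRootEquivEisenstein : eisensteinPair.lattice ≃ eisensteinPair.lattice where
  toFun x := ⟨cubeRoot * x, cubeRoot_mul_mem_eisenstein x.2⟩
  invFun x := ⟨cubeRoot * (cubeRoot * x),
    cubeRoot_mul_mem_eisenstein (cubeRoot_mul_mem_eisenstein x.2)⟩
  left_inv x := Subtype.ext (by
    change cubeRoot * (cubeRoot * (cubeRoot * (x : ℂ))) = x
    linear_combination (x : ℂ) * cubeRoot_pow_three)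
  right_inv x := Subtype.ext (by
    change cubeRoot * (cubeRoot * (cubeRoot * (x : ℂ))) = x
    linear_combination (x : ℂ) * cubeRoot_pow_three)

/-- Reindexing the sum by the rotation multiplies it by `cubeRoot⁻⁴ = cubeRoot²`, which is not 1. -/
lemma G_four_eisenstein : eisensteinPair.G 4 = 0 := by
  have h : eisensteinPair.G 4 = cubeRoot ^ 2 * eisensteinPair.G 4 := by
    conv_lhs => rw [PeriodPair.G, ← cubeRootEquivEisenstein.tsum_eq]
    rw [PeriodPair.G, ← tsum_mul_left]
    refine tsum_congr fun x => ?_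
    change ((cubeRoot * (x : ℂ)) ^ 4)⁻¹ = _
    rw [mul_pow, mul_inv]
    congr 1
    refine inv_eq_of_mul_eq_one_left ?_
    linear_combination (cubeRoot ^ 3 + 1) * cubeRoot_pow_three
  have h2 : (2 + cubeRoot) * eisensteinPair.G 4 = 0 := by
    linear_combination h + eisensteinPair.G 4 * cubeRoot_sq
  refine (mul_eq_zero.1 h2).resolve_left fun h3 => ?_
  have := congrArg Complex.re h3
  norm_num [cubeRoot] at this

lemma conj_G_eisenstein (n : ℕ) :
    (starRingEnd ℂ) (eisensteinPair.G n) = eisensteinPair.G n := by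
  rw [PeriodPair.G, Complex.conj_tsum, ← conjEquivEisenstein.tsum_eq]
  exact tsum_congr fun x => by simp [conjEquivEisenstein]

lemma weierstrassP_conj_eisenstein (z : ℂ) :
    ℘[eisensteinPair] ((starRingEnd ℂ) z) = (starRingEnd ℂ) (℘[eisensteinPair] z) := by
  rw [PeriodPair.weierstrassP, PeriodPair.weierstrassP, Complex.conj_tsum,
    ← conjEquivEisenstein.tsum_eq]
  exact tsum_congr fun x => by simp [conjEquivEisenstein]

lemma derivWeierstrassP_conj_eisenstein (z : ℂ) :
    ℘'[eisensteinPair] ((starRingEnd ℂ) z) = (starRingEnd ℂ) (℘'[eisensteinPair] z) := by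
  rw [PeriodPair.derivWeierstrassP, PeriodPair.derivWeierstrassP, map_neg, Complex.conj_tsum,
    ← conjEquivEisenstein.tsum_eq]
  exact congrArg _ (tsum_congr fun x => by simp [conjEquivEisenstein, Complex.conj_ofNat])

lemma weierstrassP_cubeRoot_mul (z : ℂ) :
    ℘[eisensteinPair] (cubeRoot * z) = cubeRoot * ℘[eisensteinPair] z := by
  rw [PeriodPair.weierstrassP, PeriodPair.weierstrassP, ← cubeRootEquivEisenstein.tsum_eq,
    ← tsum_mul_left]
  refine tsum_congr fun x => ?_
  change 1 / (cubeRoot * z - cubeRoot * x) ^ 2 - 1 / (cubeRoot * x) ^ 2 = _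
  have h : (cubeRoot ^ 2)⁻¹ = cubeRoot :=
    inv_eq_of_mul_eq_one_left (by linear_combination cubeRoot_pow_three)
  rw [← mul_sub, mul_pow, mul_pow, one_div, one_div, mul_inv, mul_inv, h]
  ring

/-- Conjugation sends `I * t` to its negative, so evenness makes `℘` real on the imaginary axis; in
the next lemma oddness makes `℘'` purely imaginary. -/
lemma weierstrassP_I_mul (t : ℝ) :
    ℘[eisensteinPair] (I * t) = ((℘[eisensteinPair] (I * t)).re : ℂ) := by
  have h := weierstrassP_conj_eisenstein (I * t)
  rw [map_mul, Complex.conj_I, Complex.conj_ofReal, neg_mul, PeriodPair.weierstrassP_neg] at h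
  exact (Complex.conj_eq_iff_re.1 h.symm).symm

lemma derivWeierstrassP_I_mul (t : ℝ) :
    ℘'[eisensteinPair] (I * t) = ((℘'[eisensteinPair] (I * t)).im : ℂ) * I := by
  have h := derivWeierstrassP_conj_eisenstein (I * t)
  rw [map_mul, Complex.conj_I, Complex.conj_ofReal, neg_mul, PeriodPair.derivWeierstrassP_neg] at h
  have h2 := congrArg Complex.re h
  rw [Complex.conj_re, Complex.neg_re] at h2
  apply Complex.ext <;> simp
  linarith

lemma I_mul_notMem_eisenstein {t : ℝ} (h0 : 0 < t) (h1 : t < √3) :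
    I * t ∉ eisensteinPair.lattice := by
  intro h
  obtain ⟨m, n, hmn⟩ := mem_eisenstein_lattice.1 h
  have him := congrArg Complex.im hmn
  have hre := congrArg Complex.re hmn
  simp [cubeRoot] at him hre
  have h3 : (0 : ℝ) < √3 := by positivity
  have hm : (m : ℝ) = 2 * n := by linarith
  rw [hm] at him
  have hn : n * √3 = t := by linarith
  have h4 : (0 : ℝ) < n := by
    by_contra hcon
    nlinarith
  have h5 : (n : ℝ) < 1 := by
    by_contra hcon
    nlinarith
  have h6 : 0 < n := by exact_mod_cast h4
  have h7 : n < 1 := by exact_mod_cast h5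
  omega

lemma g₃_eisenstein_eq_re : eisensteinPair.g₃ = (eisensteinPair.g₃.re : ℂ) := by
  refine (Complex.conj_eq_iff_re.1 ?_).symm
  rw [PeriodPair.g₃, map_mul, conj_G_eisenstein, Complex.conj_ofNat]

lemma g₃_eisenstein_ne_zero : eisensteinPair.g₃ ≠ 0 := by
  intro h
  have h1 := norm_modularDelta_of_G_four_eq_zero cubeRootPoint G_four_eisenstein
  change _ = 27 * ‖eisensteinPair.g₃‖ ^ 2 at h1
  rw [h] at h1
  have h2 : modularDelta cubeRootPoint ≠ 0 :=
    mul_ne_zero (by simp [Real.pi_ne_zero]) (ModularForm.discriminant_ne_zero _)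
  simp at h1
  exact h2 h1

/-- `℘` on the imaginary axis is minus a real solution of `Q'² = 4 Q³ + g₃`. -/
lemma hasDerivAt_neg_weierstrassP_I_mul {t : ℝ} (h0 : 0 < t) (h1 : t < √3) :
    HasDerivAt (fun t : ℝ => -(℘[eisensteinPair] (I * t)).re)
      (℘'[eisensteinPair] (I * t)).im t := by
  have hI : HasDerivAt (fun z : ℂ => I * z) I t := by
    simpa using (hasDerivAt_id (t : ℂ)).const_mul I
  have h := ((hasDerivAt_weierstrassP (I_mul_notMem_eisenstein h0 h1)).comp (t : ℂ) hI).fun_neg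
  simpa using h.real_of_complex

lemma hasDerivAt_derivWeierstrassP_I_mul {t : ℝ} (h0 : 0 < t) (h1 : t < √3) :
    HasDerivAt (fun t : ℝ => (℘'[eisensteinPair] (I * t)).im)
      (6 * (℘[eisensteinPair] (I * t)).re ^ 2) t := by
  have hI : HasDerivAt (fun z : ℂ => I * z) I t := by
    simpa using (hasDerivAt_id (t : ℂ)).const_mul I
  have h := ((hasDerivAt_derivWeierstrassP G_four_eisenstein
    (I_mul_notMem_eisenstein h0 h1)).comp (t : ℂ) hI).const_mul (-I)
  have h2 := h.real_of_complex
  rw [weierstrassP_I_mul] at h2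
  convert h2 using 1
  · simp
  · have : -I * (6 * ((℘[eisensteinPair] (I * t)).re : ℂ) ^ 2 * I) =
        ((6 * (℘[eisensteinPair] (I * t)).re ^ 2 : ℝ) : ℂ) := by
      push_cast
      linear_combination -(6 * ((℘[eisensteinPair] (I * t)).re : ℂ) ^ 2) * Complex.I_sq
    rw [this, Complex.ofReal_re]

lemma derivWeierstrassP_I_mul_sq {t : ℝ} (h0 : 0 < t) (h1 : t < √3) :
    (℘'[eisensteinPair] (I * t)).im ^ 2 =
      4 * (-(℘[eisensteinPair] (I * t)).re) ^ 3 + eisensteinPair.g₃.re := by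
  have h := derivWeierstrassP_sq_of_G_four_eq_zero G_four_eisenstein
    (I_mul_notMem_eisenstein h0 h1)
  rw [derivWeierstrassP_I_mul, weierstrassP_I_mul, g₃_eisenstein_eq_re, mul_pow, Complex.I_sq] at h
  have h2 : ((℘'[eisensteinPair] (I * t)).im ^ 2 * -1 : ℝ) =
      4 * (℘[eisensteinPair] (I * t)).re ^ 3 - eisensteinPair.g₃.re := by exact_mod_cast h
  linear_combination -h2

/-- The point `i/√3` is fixed by the rotation modulo the lattice, while the rotation multiplies `℘`
by `cubeRoot ≠ 1`. -/
lemma weierstrassP_I_div_sqrt_three : ℘[eisensteinPair] (I * (1 / √3 : ℝ)) = 0 := by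
  have h3 : √3 * √3 = 3 := Real.mul_self_sqrt (by norm_num)
  have h3' : √3 ≠ 0 := by positivity
  have h1 : cubeRoot * (I * (1 / √3 : ℝ)) = I * (1 / √3 : ℝ) + (-cubeRoot - 1) := by
    apply Complex.ext <;> simp [cubeRoot] <;> field_simp <;> nlinarith
  have h2 : -cubeRoot - 1 ∈ eisensteinPair.lattice :=
    mem_eisenstein_lattice.2 ⟨-1, -1, by push_cast; ring⟩
  have h4 := weierstrassP_cubeRoot_mul (I * (1 / √3 : ℝ))
  rw [h1, eisensteinPair.weierstrassP_add_coe _ ⟨_, h2⟩] at h4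
  have h5 : (1 - cubeRoot) * ℘[eisensteinPair] (I * (1 / √3 : ℝ)) = 0 := by
    linear_combination h4
  exact (mul_eq_zero.1 h5).resolve_left fun h => cubeRoot_ne_one (sub_eq_zero.1 h).symm

/-- The point is half of the period `i√3 = 2 * cubeRoot + 1`, and `℘'` is odd. -/
lemma derivWeierstrassP_I_mul_half : (℘'[eisensteinPair] (I * (√3 / 2 : ℝ))).im = 0 := by
  have h1 : I * (√3 / 2 : ℝ) = -(I * (√3 / 2 : ℝ)) + (2 * cubeRoot + 1) := by
    apply Complex.ext <;> simp [cubeRoot] <;> ring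
  have h2 : 2 * cubeRoot + 1 ∈ eisensteinPair.lattice :=
    mem_eisenstein_lattice.2 ⟨2, 1, by push_cast; ring⟩
  have h3 : ℘'[eisensteinPair] (I * (√3 / 2 : ℝ)) = -℘'[eisensteinPair] (I * (√3 / 2 : ℝ)) := by
    conv_lhs => rw [h1, eisensteinPair.derivWeierstrassP_add_coe _ ⟨_, h2⟩,
      PeriodPair.derivWeierstrassP_neg]
  have h4 := congrArg Complex.im h3
  rw [Complex.neg_im] at h4
  linarith

/-- The lattice invariant of the Eisenstein integers as a value of the beta function. -/
lemma beta_pow_six_eq_norm_g₃_eisenstein :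
    ProbabilityTheory.beta (1 / 6) (1 / 3) ^ 6 =
      12 ^ 6 / 4 ^ 4 * ‖eisensteinPair.g₃‖ * (1 / √3) ^ 6 := by
  have h3 : √3 * √3 = 3 := Real.mul_self_sqrt (by norm_num)
  have h3' : 0 < √3 := by positivity
  have hT0 : 0 < 1 / √3 := by positivity
  have hThalf : 1 / √3 ≤ √3 / 2 := by
    rw [div_le_div_iff₀ h3' two_pos]; linarith
  have hhalf : √3 / 2 < √3 := by linarith
  set Q : ℝ → ℝ := fun t => -(℘[eisensteinPair] (I * t)).re with hQ
  set Q' : ℝ → ℝ := fun t => (℘'[eisensteinPair] (I * t)).im with hQ'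
  -- Monotonicity, from `Q'' = 6Q² ≥ 0`, fixes the sign of `Q'`: it vanishes at the half period
  -- `√3/2`, so it is nonpositive up to `1/√3`. It is nonzero at `1/√3` because its square there is
  -- `g₃ ≠ 0`.
  have hmono : MonotoneOn Q' (Set.Ioo 0 √3) := by
    refine monotoneOn_of_deriv_nonneg (convex_Ioo 0 √3)
      (fun t ht => (hasDerivAt_derivWeierstrassP_I_mul ht.1 ht.2).continuousAt.continuousWithinAt)
      (fun t ht => ?_) fun t ht => ?_ <;> rw [interior_Ioo] at ht
    · exact (hasDerivAt_derivWeierstrassP_I_mul ht.1 ht.2).differentiableAt.differentiableWithinAt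
    · rw [(hasDerivAt_derivWeierstrassP_I_mul ht.1 ht.2).deriv]
      positivity
  have hTmem : 1 / √3 ∈ Set.Ioo 0 √3 := ⟨hT0, hThalf.trans_lt hhalf⟩
  have hQT : Q (1 / √3) = 0 := by
    simp only [hQ]
    rw [weierstrassP_I_div_sqrt_three]; simp
  have hsqT : Q' (1 / √3) ^ 2 = eisensteinPair.g₃.re := by
    have := derivWeierstrassP_I_mul_sq hTmem.1 hTmem.2
    simp only [hQ, neg_eq_zero] at hQT
    rw [hQT, neg_zero, zero_pow three_ne_zero, mul_zero, zero_add] at this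
    exact this
  have hg : 0 < eisensteinPair.g₃.re := by
    refine lt_of_le_of_ne (hsqT ▸ sq_nonneg _) fun h => g₃_eisenstein_ne_zero ?_
    rw [g₃_eisenstein_eq_re, ← h, Complex.ofReal_zero]
  have hQ'T : Q' (1 / √3) < 0 := by
    have h1 : Q' (1 / √3) ≤ Q' (√3 / 2) := hmono hTmem ⟨by positivity, hhalf⟩ hThalf
    have h2 : Q' (√3 / 2) = 0 := derivWeierstrassP_I_mul_half
    refine lt_of_le_of_ne (h2 ▸ h1) fun h => ?_
    rw [h] at hsqT
    simp at hsqT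
    exact hg.ne hsqT
  have hmem : ∀ t ∈ Set.Ioc 0 (1 / √3), t ∈ Set.Ioo 0 √3 := fun t ht =>
    ⟨ht.1, ht.2.trans_lt hTmem.2⟩
  have hneg : ∀ t ∈ Set.Ioc 0 (1 / √3), Q' t < 0 := fun t ht =>
    (hmono (hmem t ht) hTmem ht.2).trans_lt hQ'T
  have hderiv : ∀ t ∈ Set.Ioc 0 (1 / √3), HasDerivAt Q (Q' t) t := fun t ht =>
    hasDerivAt_neg_weierstrassP_I_mul (hmem t ht).1 (hmem t ht).2
  have hanti : AntitoneOn Q (Set.Ioc 0 (1 / √3)) := by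
    refine antitoneOn_of_deriv_nonpos (convex_Ioc 0 _)
      (fun t ht => (hderiv t ht).continuousAt.continuousWithinAt)
      (fun t ht => ?_) fun t ht => ?_ <;>
      replace ht := interior_subset ht
    · exact (hderiv t ht).differentiableAt.differentiableWithinAt
    · rw [(hderiv t ht).deriv]
      exact (hneg t ht).le
  have hlim : Tendsto Q (𝓝[>] 0) atTop := by
    have h1 : Tendsto (fun t : ℝ => I * (t : ℂ)) (𝓝[>] 0) (𝓝[≠] 0) := by
      refine tendsto_nhdsWithin_iff.2 ⟨?_, ?_⟩
      · have : Continuous fun t : ℝ => I * (t : ℂ) := by fun_prop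
        simpa using (this.tendsto 0).mono_left nhdsWithin_le_nhds
      · filter_upwards [self_mem_nhdsWithin] with t ht
        simpa using (ne_of_gt ht : t ≠ 0)
    refine ((tendsto_norm_weierstrassP eisensteinPair
      eisensteinPair.lattice.zero_mem).comp h1).congr' ?_
    filter_upwards [Ioc_mem_nhdsGT hT0] with t ht
    have h2 : 0 ≤ Q t := hQT ▸ hanti ht ⟨hT0, le_rfl⟩ ht.2
    simp only [Function.comp, hQ] at h2 ⊢
    rw [weierstrassP_I_mul, Complex.norm_real, Complex.ofReal_re, Real.norm_eq_abs,
      abs_of_nonpos (by linarith)]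
  have hnorm : ‖eisensteinPair.g₃‖ = eisensteinPair.g₃.re := by
    rw [g₃_eisenstein_eq_re, Complex.norm_real, Complex.ofReal_re, Real.norm_of_nonneg hg.le]
  rw [hnorm]
  exact beta_pow_six_of_ode hT0 hg hderiv
    (fun t ht => derivWeierstrassP_I_mul_sq (hmem t ht).1 (hmem t ht).2) hneg hQT hlim

/-- The archimedean contribution of a complex elliptic curve with vanishing `j`-invariant. -/
lemma norm_modularDelta_mul_im_pow_of_modularJ_eq_zero {τ : ℍ} (h : modularJ τ = 0) :
    ‖modularDelta τ‖ * τ.im ^ 6 =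
      (Real.pi * (1 / √3 * (Real.Gamma (1 / 3) / Real.Gamma (2 / 3)) ^ 3)) ^ 6 := by
  rw [modularJ_eq_zero_iff] at h
  obtain ⟨l, hl, hmem⟩ :=
    exists_mem_lattice_iff_mem_eisenstein fun x hx => cubeRoot_mul_mem_lattice h hx
  have hg : ‖(periodPairOfTau τ).g₃‖ = ‖eisensteinPair.g₃‖ / ‖l‖ ^ 6 := by
    rw [PeriodPair.g₃, PeriodPair.g₃, G_eq_of_mem_lattice_iff hl hmem]
    simp
    ring
  have hl' : ‖l‖ ≠ 0 := norm_ne_zero_iff.2 hl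
  have hbeta := beta_pow_six_eq_norm_g₃_eisenstein
  have hbeta2 := beta_sixth_third_pow_twelve
  have h3 : √3 ^ 2 = 3 := Real.sq_sqrt (by norm_num)
  have h36 : √3 ^ 6 = 27 := by rw [show 6 = 2 * 3 from rfl, pow_mul, h3]; norm_num
  rw [norm_modularDelta_of_G_four_eq_zero τ h, im_eq_of_mem_lattice_iff hl hmem, hg]
  rw [div_pow, h36] at hbeta
  -- Homothety invariance: the powers of `‖l‖` cancel.
  have e : 27 * (‖eisensteinPair.g₃‖ / ‖l‖ ^ 6) ^ 2 * (‖l‖ ^ 2 * (√3 / 2)) ^ 6 =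
      27 * ‖eisensteinPair.g₃‖ ^ 2 * (√3 ^ 6 / 2 ^ 6) := by
    field_simp
  rw [e, h36]
  have hb12 : ProbabilityTheory.beta (1 / 6) (1 / 3) ^ 12 =
      (12 ^ 6 / 4 ^ 4 * ‖eisensteinPair.g₃‖ * (1 ^ 6 / 27)) ^ 2 := by
    rw [← hbeta]; ring
  rw [hb12] at hbeta2
  linear_combination hbeta2 / 2 ^ 14

/-- The choice made by `tauOfJ` is meaningful only if a point with `j = 0` exists; the cube root of
unity is one. -/
lemma modularJ_tauOfJ_zero : modularJ (tauOfJ 0) = 0 :=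
  Classical.epsilon_spec (p := fun τ : ℍ => modularJ τ = 0)
    ⟨cubeRootPoint, (modularJ_eq_zero_iff _).2 G_four_eisenstein⟩

end FaltingsGap
-- Local minimal equations and the minimal discriminant ideal
namespace FaltingsGap

open scoped NumberField
open IsDedekindDomain NumberField

variable {K : Type*} [Field K] [NumberField K]

/-- The valuation attached to the maximal ideal of the ring of `v`-integers of `K` is equivalent
to `v`. -/
lemma isEquiv_valuation_maximalIdeal_integer (v : HeightOneSpectrum (𝓞 K)) :
    ((IsDiscreteValuationRing.maximalIdeal (v.valuation K).integer).valuation K).IsEquiv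
      (v.valuation K) := by
  have hunit : ∀ r : (v.valuation K).integer,
      (IsDiscreteValuationRing.maximalIdeal (v.valuation K).integer).valuation K (r : K) = 1 ↔
        v.valuation K (r : K) = 1 := by
    intro r
    have h1 : v.valuation K (r : K) = 1 ↔ IsUnit r :=
      (Valuation.integer.integers (v.valuation K)).isUnit_iff_valuation_eq_one.symm
    rw [h1, ← not_iff_not, ← IsLocalRing.notMem_maximalIdeal, not_not]
    refine Iff.trans ?_ (HeightOneSpectrum.valuation_lt_one_iff_mem (K := K)
      (IsDiscreteValuationRing.maximalIdeal (v.valuation K).integer) r)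
    exact ⟨fun h => lt_of_le_of_ne (HeightOneSpectrum.valuation_le_one _ r) h, fun h => h.ne⟩
  rw [Valuation.isEquiv_iff_val_eq_one]
  intro x
  rcases le_total (v.valuation K x) 1 with h | h
  · exact hunit ⟨x, h⟩
  · have h' : v.valuation K x⁻¹ ≤ 1 := by
      rw [map_inv₀]; exact inv_le_one_of_one_le₀ h
    simpa using hunit ⟨x⁻¹, h'⟩

/-- The discriminant of a `v`-integral equation is at most that of a `v`-minimal equation. -/
lemma valuation_Δ_le_valuation_minimal_Δ (E : WeierstrassCurve K) (v : HeightOneSpectrum (𝓞 K))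
    (C : WeierstrassCurve.VariableChange K)
    (h₁ : v.valuation K (C • E).a₁ ≤ 1) (h₂ : v.valuation K (C • E).a₂ ≤ 1)
    (h₃ : v.valuation K (C • E).a₃ ≤ 1) (h₄ : v.valuation K (C • E).a₄ ≤ 1)
    (h₆ : v.valuation K (C • E).a₆ ≤ 1) :
    v.valuation K (C • E).Δ ≤ v.valuation K (E.minimal (v.valuation K).integer).Δ := by
  have hint : WeierstrassCurve.IsIntegral (v.valuation K).integer (C • E) :=
    WeierstrassCurve.isIntegral_of_exists_lift _ ⟨⟨_, h₁⟩, rfl⟩ ⟨⟨_, h₂⟩, rfl⟩ ⟨⟨_, h₃⟩, rfl⟩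
      ⟨⟨_, h₄⟩, rfl⟩ ⟨⟨_, h₆⟩, rfl⟩
  set M := E.minimal (v.valuation K).integer with hM
  obtain ⟨D, hD⟩ : ∃ D : WeierstrassCurve.VariableChange K, D • M = C • E :=
    ⟨C * (E.exists_isMinimal (v.valuation K).integer).choose⁻¹, by
      rw [hM, WeierstrassCurve.minimal, mul_smul, inv_smul_smul]⟩
  have hle : WeierstrassCurve.valuation_Δ_aux (v.valuation K).integer (C • E) ≤
      WeierstrassCurve.valuation_Δ_aux (v.valuation K).integer M := by
    have hmax := (WeierstrassCurve.IsMinimal.val_Δ_maximal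
      (R := (v.valuation K).integer) (W := M)).2 (j := D) (by simpa only [hD] using hint)
    simp only [hD, one_smul] at hmax
    rcases le_total (WeierstrassCurve.valuation_Δ_aux (v.valuation K).integer (C • E))
      (WeierstrassCurve.valuation_Δ_aux (v.valuation K).integer M) with h | h
    · exact h
    · exact hmax h
  rw [← Subtype.coe_le_coe, WeierstrassCurve.valuation_Δ_aux_eq_of_isIntegral,
    WeierstrassCurve.valuation_Δ_aux_eq_of_isIntegral] at hle
  exact ((isEquiv_valuation_maximalIdeal_integer v).le_iff_le).1 hle

lemma valuation_minimal_Δ_le_one (E : WeierstrassCurve K) (v : HeightOneSpectrum (𝓞 K)) :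
    v.valuation K (E.minimal (v.valuation K).integer).Δ ≤ 1 := by
  obtain ⟨r, hr⟩ := WeierstrassCurve.Δ_integral_of_isIntegral (v.valuation K).integer
    (E.minimal (v.valuation K).integer)
  rw [← hr]
  exact r.2

/-- Consequently the order of the discriminant modulo 12 can be read off from any equation. -/
lemma exists_minimal_Δ_eq (E : WeierstrassCurve K) (v : HeightOneSpectrum (𝓞 K)) :
    ∃ u : Kˣ, (E.minimal (v.valuation K).integer).Δ = (u : K) ^ 12 * E.Δ :=
  ⟨_, WeierstrassCurve.variableChange_Δ E _⟩

/-- The truncation `toNat` loses nothing, since a minimal equation is integral with nonzero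
discriminant. -/
lemma exp_neg_minimalDiscriminantExponent (E : WeierstrassCurve K) [E.IsElliptic]
    (v : HeightOneSpectrum (𝓞 K)) :
    v.valuation K (E.minimal (v.valuation K).integer).Δ =
      WithZero.exp (-(minimalDiscriminantExponent E v : ℤ)) := by
  obtain ⟨u, hu⟩ := exists_minimal_Δ_eq E v
  have h0 : v.valuation K (E.minimal (v.valuation K).integer).Δ ≠ 0 := by
    rw [Valuation.ne_zero_iff, hu]
    exact mul_ne_zero (pow_ne_zero _ u.ne_zero) E.isUnit_Δ.ne_zero
  have h1 : WithZero.log (v.valuation K (E.minimal (v.valuation K).integer).Δ) ≤ 0 := by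
    rw [WithZero.log_le_iff_le_exp h0]
    exact valuation_minimal_Δ_le_one E v
  rw [minimalDiscriminantExponent, Int.toNat_of_nonneg (by omega), neg_neg, WithZero.exp_log h0]

lemma hasFiniteMulSupport_minimalDiscriminant (E : WeierstrassCurve K) [E.IsElliptic] :
    (fun v : HeightOneSpectrum (𝓞 K) =>
      v.asIdeal ^ minimalDiscriminantExponent E v).HasFiniteMulSupport := by
  refine (finite_minimalDiscriminantExponent_ne_zero E).subset fun v hv h0 => hv ?_
  simp [h0]

/-- The minimal discriminant divides every ideal that it divides locally. -/
lemma minimalDiscriminant_dvd (E : WeierstrassCurve K) [E.IsElliptic] {I : Ideal (𝓞 K)}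
    (h : ∀ v : HeightOneSpectrum (𝓞 K), v.asIdeal ^ minimalDiscriminantExponent E v ∣ I) :
    minimalDiscriminant E ∣ I := by
  rw [minimalDiscriminant, finprod_eq_prod_of_mulSupport_toFinset_subset _
    (hasFiniteMulSupport_minimalDiscriminant E) subset_rfl]
  exact Finset.prod_dvd_of_coprime
    (fun v _ w _ hvw => (HeightOneSpectrum.isCoprime_of_ne v w hvw).pow) fun v _ => h v

/-! ### The curve `y² = x³ + 1` over a field containing a root of 6 -/

section MordellCurve

/-- The curve `y² = x³ + 1`. -/
def mordellCurve (F : Type*) [Field F] : WeierstrassCurve F := ⟨0, 0, 0, 0, 1⟩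

variable {F : Type*} [Field F]

lemma mordellCurve_Δ : (mordellCurve F).Δ = -432 := by
  simp [mordellCurve, WeierstrassCurve.Δ, WeierstrassCurve.b₂, WeierstrassCurve.b₄,
    WeierstrassCurve.b₆, WeierstrassCurve.b₈]
  norm_num

instance [CharZero F] : (mordellCurve F).IsElliptic :=
  ⟨by rw [mordellCurve_Δ]; exact isUnit_iff_ne_zero.2 (by norm_num)⟩

lemma mordellCurve_j [CharZero F] : (mordellCurve F).j = 0 := by
  rw [WeierstrassCurve.j_eq_zero_iff]
  simp [mordellCurve, WeierstrassCurve.c₄, WeierstrassCurve.b₂, WeierstrassCurve.b₄]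

end MordellCurve

lemma valuation_ofNat_le_one (v : HeightOneSpectrum (𝓞 K)) (n : ℕ) : v.valuation K (n : K) ≤ 1 := by
  simpa using v.valuation_le_one (K := K) (n : 𝓞 K)

/-- Because `3 - 2 = 1`. -/
lemma valuation_two_or_three_eq_one (v : HeightOneSpectrum (𝓞 K)) :
    v.valuation K 2 = 1 ∨ v.valuation K 3 = 1 := by
  by_contra! hcon
  have h2 := lt_of_le_of_ne (by exact_mod_cast valuation_ofNat_le_one v 2) hcon.1
  have h3 := lt_of_le_of_ne (by exact_mod_cast valuation_ofNat_le_one v 3) hcon.2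
  have h := Valuation.map_sub_lt (v.valuation K) h3 h2
  norm_num at h

section Radical

variable {m : ℕ} {π : 𝓞 K}

lemma valuation_two_mul_valuation_three (hπ : π ^ (12 * m + 1) = 6) (v : HeightOneSpectrum (𝓞 K)) :
    v.valuation K 2 * v.valuation K 3 = v.valuation K (π : K) ^ (12 * m + 1) := by
  have h : (π : K) ^ (12 * m + 1) = 6 := by
    rw [← RingHom.map_pow, hπ]
    exact map_ofNat (algebraMap (𝓞 K) K) 6
  rw [← map_mul, ← map_pow, h]
  norm_num

lemma valuation_mordellCurve_Δ (v : HeightOneSpectrum (𝓞 K)) :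
    v.valuation K (mordellCurve K).Δ = v.valuation K 2 ^ 4 * v.valuation K 3 ^ 3 := by
  rw [mordellCurve_Δ, Valuation.map_neg, ← map_pow, ← map_pow, ← map_mul]
  norm_num

lemma valuation_pow_four_le_valuation_minimal_Δ (hπ : π ^ (12 * m + 1) = 6)
    (v : HeightOneSpectrum (𝓞 K)) :
    v.valuation K (π : K) ^ 4 ≤
      v.valuation K ((mordellCurve K).minimal (v.valuation K).integer).Δ := by
  have hπ0 : (π : K) ≠ 0 := by
    have : π ≠ 0 := fun h => by
      rw [h, zero_pow (by omega)] at hπ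
      exact absurd hπ (by norm_num)
    exact_mod_cast this
  have hx0 : v.valuation K (π : K) ≠ 0 := (Valuation.ne_zero_iff _).2 hπ0
  have hx1 : v.valuation K (π : K) ≤ 1 := v.valuation_le_one π
  have h23 := valuation_two_mul_valuation_three hπ v
  have hΔ := valuation_mordellCurve_Δ v
  set x := v.valuation K (π : K) with hx
  rcases valuation_two_or_three_eq_one v with h2 | h3
  · rw [h2, one_mul] at h23
    -- Moving the 2-torsion point `(-1, 0)` to the origin gives `y² = x³ - 3x² + 3x`. As 3 has the
    -- valuation of `π ^ (12m + 1)`, the scaling `u = π ^ (3m)` keeps this integral and leaves a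
    -- discriminant with the valuation of `π³`.
    let C : WeierstrassCurve.VariableChange K :=
      ⟨Units.mk0 ((π : K) ^ (3 * m)) (by simp [hπ0]), -1, 0, 0⟩
    have hu : v.valuation K (C.u⁻¹ : Kˣ) = (x ^ (3 * m))⁻¹ := by simp [C, hx]
    have e1 : (C • mordellCurve K).a₁ = 0 := by
      simp [WeierstrassCurve.variableChange_a₁, mordellCurve, C]
    have e2 : (C • mordellCurve K).a₂ = -(((C.u⁻¹ : Kˣ) : K) ^ 2 * 3) := by
      simp [WeierstrassCurve.variableChange_a₂, mordellCurve, C]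
    have e3 : (C • mordellCurve K).a₃ = 0 := by
      simp [WeierstrassCurve.variableChange_a₃, mordellCurve, C]
    have e4 : (C • mordellCurve K).a₄ = ((C.u⁻¹ : Kˣ) : K) ^ 4 * 3 := by
      simp [WeierstrassCurve.variableChange_a₄, mordellCurve, C]
    have e6 : (C • mordellCurve K).a₆ = 0 := by
      simp [WeierstrassCurve.variableChange_a₆, mordellCurve, C]
      norm_num
    refine le_trans ?_ (valuation_Δ_le_valuation_minimal_Δ _ v C (by simp [e1]) ?_ (by simp [e3]) ?_
      (by simp [e6]))
    · rw [WeierstrassCurve.variableChange_Δ, map_mul, map_pow, hΔ, h2, h23, hu]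
      have : (x ^ (3 * m))⁻¹ ^ 12 * (1 ^ 4 * (x ^ (12 * m + 1)) ^ 3) = x ^ 3 := by
        field_simp
        simp only [← pow_mul, ← pow_add]
        congr 1
        ring
      rw [this]
      exact pow_le_pow_right_of_le_one' hx1 (by norm_num)
    · rw [e2, Valuation.map_neg, map_mul, map_pow, hu, h23]
      have : (x ^ (3 * m))⁻¹ ^ 2 * x ^ (12 * m + 1) = x ^ (6 * m + 1) := by
        field_simp
        simp only [← pow_mul, ← pow_add]
        congr 1
        ring
      rw [this]
      exact pow_le_one' hx1 _
    · rw [e4, map_mul, map_pow, hu, h23]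
      have : (x ^ (3 * m))⁻¹ ^ 4 * x ^ (12 * m + 1) = x := by
        field_simp
        simp only [← pow_mul, ← pow_succ]
        congr 1
        ring
      rwa [this]
  · rw [h3, mul_one] at h23
    -- Moving the 3-torsion point `(0, 1)` to the origin gives `y² + 2y = x³`. As 2 has the
    -- valuation of `π ^ (12m + 1)`, the scaling `u = π ^ (4m)` is allowed and leaves a discriminant
    -- with the valuation of `π⁴`.
    let C : WeierstrassCurve.VariableChange K :=
      ⟨Units.mk0 ((π : K) ^ (4 * m)) (by simp [hπ0]), 0, 0, 1⟩
    have hu : v.valuation K (C.u⁻¹ : Kˣ) = (x ^ (4 * m))⁻¹ := by simp [C, hx]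
    have e1 : (C • mordellCurve K).a₁ = 0 := by
      simp [WeierstrassCurve.variableChange_a₁, mordellCurve, C]
    have e2 : (C • mordellCurve K).a₂ = 0 := by
      simp [WeierstrassCurve.variableChange_a₂, mordellCurve, C]
    have e3 : (C • mordellCurve K).a₃ = ((C.u⁻¹ : Kˣ) : K) ^ 3 * 2 := by
      simp [WeierstrassCurve.variableChange_a₃, mordellCurve, C]
    have e4 : (C • mordellCurve K).a₄ = 0 := by
      simp [WeierstrassCurve.variableChange_a₄, mordellCurve, C]
    have e6 : (C • mordellCurve K).a₆ = 0 := by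
      simp [WeierstrassCurve.variableChange_a₆, mordellCurve, C]
    refine le_trans ?_ (valuation_Δ_le_valuation_minimal_Δ _ v C (by simp [e1]) (by simp [e2]) ?_
      (by simp [e4]) (by simp [e6]))
    · rw [WeierstrassCurve.variableChange_Δ, map_mul, map_pow, hΔ, h3, h23, hu]
      have : (x ^ (4 * m))⁻¹ ^ 12 * ((x ^ (12 * m + 1)) ^ 4 * 1 ^ 3) = x ^ 4 := by
        field_simp
        simp only [← pow_mul, ← pow_add]
        congr 1
        ring
      rw [this]
    · rw [e3, map_mul, map_pow, hu, h23]
      have : (x ^ (4 * m))⁻¹ ^ 3 * x ^ (12 * m + 1) = x := by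
        field_simp
        simp only [← pow_mul, ← pow_succ]
        congr 1
        ring
      rwa [this]

lemma minimalDiscriminant_mordellCurve_dvd (hπ : π ^ (12 * m + 1) = 6) :
    minimalDiscriminant (mordellCurve K) ∣ Ideal.span {π} ^ 4 := by
  refine minimalDiscriminant_dvd _ fun v => ?_
  rw [Ideal.span_singleton_pow, ← v.intValuation_le_pow_iff_dvd,
    ← exp_neg_minimalDiscriminantExponent, ← v.valuation_of_algebraMap (K := K)]
  change v.valuation K (algebraMap (𝓞 K) K (π ^ 4)) ≤ _
  rw [map_pow, map_pow]
  exact valuation_pow_four_le_valuation_minimal_Δ hπ v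

/-- The discriminant has order `3(12m + 1)` or `4(12m + 1)` at `v`, which is 3 or 4 modulo 12, so no
change of equation makes it a unit. -/
lemma minimalDiscriminantExponent_mordellCurve_ne_zero (hπ : π ^ (12 * m + 1) = 6)
    (v : HeightOneSpectrum (𝓞 K)) (hv : v.valuation K (π : K) = WithZero.exp (-1)) :
    minimalDiscriminantExponent (mordellCurve K) v ≠ 0 := by
  intro h0
  have h1 := exp_neg_minimalDiscriminantExponent (mordellCurve K) v
  obtain ⟨u, hu⟩ := exists_minimal_Δ_eq (mordellCurve K) v
  have hu0 : v.valuation K (u : K) ≠ 0 := (Valuation.ne_zero_iff _).2 u.ne_zero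
  have h23 := valuation_two_mul_valuation_three hπ v
  have hlog : WithZero.log (v.valuation K (π : K) ^ (12 * m + 1)) = -(12 * m + 1) := by
    rw [hv, WithZero.log_pow, WithZero.log_exp]; simp
  rw [hu, h0, map_mul, map_pow, valuation_mordellCurve_Δ] at h1
  have h2 := congrArg WithZero.log h1
  rcases valuation_two_or_three_eq_one v with h | h
  · rw [h, one_mul] at h23
    rw [h, h23, one_pow, one_mul, WithZero.log_mul (by simp [hu0]) (by simp [hv]), WithZero.log_pow,
      WithZero.log_pow, hlog, WithZero.log_exp] at h2
    simp at h2
    omega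
  · rw [h, mul_one] at h23
    rw [h, h23, one_pow, mul_one, WithZero.log_mul (by simp [hu0]) (by simp [hv]), WithZero.log_pow,
      WithZero.log_pow, hlog, WithZero.log_exp] at h2
    simp at h2
    omega

lemma absNorm_span_eq_six (hπ : π ^ (12 * m + 1) = 6) (hK : Module.finrank ℚ K = 12 * m + 1) :
    Ideal.absNorm (Ideal.span {π}) = 6 := by
  have h : Ideal.absNorm (Ideal.span {π}) ^ (12 * m + 1) = 6 ^ (12 * m + 1) := by
    rw [← map_pow, Ideal.span_singleton_pow, hπ, Ideal.absNorm_span_singleton]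
    have := Algebra.norm_algebraMap (S := 𝓞 K) (6 : ℤ)
    rw [NumberField.RingOfIntegers.rank, hK] at this
    rw [map_ofNat] at this
    rw [this, Int.natAbs_pow]
    rfl
  exact Nat.pow_left_injective (by omega) h

/-- Any prime dividing `π` divides it exactly once: a square factor would give a square factor of
the squarefree number 6. -/
lemma exists_valuation_eq_exp_neg_one (hN : Ideal.absNorm (Ideal.span {π}) = 6) :
    ∃ v : HeightOneSpectrum (𝓞 K), v.valuation K (π : K) = WithZero.exp (-1) := by
  have hπ0 : π ≠ 0 := fun h => by
    rw [h] at hN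
    simp at hN
  have htop : Ideal.span {π} ≠ ⊤ := fun h => by
    rw [h] at hN
    simp at hN
  obtain ⟨P, hP, hle⟩ := Ideal.exists_le_maximal _ htop
  have hPbot : P ≠ ⊥ := fun h => by
    rw [h, le_bot_iff, Ideal.span_singleton_eq_bot] at hle
    exact hπ0 hle
  let v : HeightOneSpectrum (𝓞 K) := ⟨P, hP.isPrime, hPbot⟩
  refine ⟨v, ?_⟩
  have h1 : v.intValuation π ≤ WithZero.exp (-((1 : ℕ) : ℤ)) := by
    rw [v.intValuation_le_pow_iff_dvd, pow_one]
    exact Ideal.dvd_iff_le.2 hle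
  have h2 : ¬ v.intValuation π ≤ WithZero.exp (-((2 : ℕ) : ℤ)) := by
    rw [v.intValuation_le_pow_iff_dvd]
    intro h
    have h3 := map_dvd Ideal.absNorm h
    rw [hN, map_pow] at h3
    have h4 : Squarefree (6 : ℕ) := by decide +kernel
    rw [pow_two] at h3
    have h5 := Nat.isUnit_iff.1 (h4 _ h3)
    rw [Ideal.absNorm_eq_one_iff] at h5
    exact hP.ne_top h5
  have h0 : v.intValuation π ≠ 0 := v.intValuation_ne_zero _ hπ0
  rw [v.valuation_of_algebraMap]
  rw [← WithZero.log_le_iff_le_exp h0] at h1 h2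
  rw [← WithZero.exp_log h0]
  congr 1
  push_cast at h1 h2
  omega

lemma log_absNorm_minimalDiscriminant_mordellCurve (hπ : π ^ (12 * m + 1) = 6)
    (hK : Module.finrank ℚ K = 12 * m + 1) :
    0 < Real.log (Ideal.absNorm (minimalDiscriminant (mordellCurve K)) : ℝ) ∧
      Real.log (Ideal.absNorm (minimalDiscriminant (mordellCurve K)) : ℝ) ≤ Real.log (6 ^ 4) := by
  have hN := absNorm_span_eq_six hπ hK
  have hdvd := map_dvd Ideal.absNorm (minimalDiscriminant_mordellCurve_dvd hπ)
  rw [map_pow, hN] at hdvd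
  set N := Ideal.absNorm (minimalDiscriminant (mordellCurve K)) with hNdef
  have hNpos : 0 < N := Nat.pos_of_dvd_of_pos hdvd (by norm_num)
  obtain ⟨v, hv⟩ := exists_valuation_eq_exp_neg_one hN
  have hN1 : N ≠ 1 := by
    intro h1
    rw [hNdef, Ideal.absNorm_eq_one_iff, minimalDiscriminant] at h1
    have h2 := finprod_mem_dvd v (hasFiniteMulSupport_minimalDiscriminant (mordellCurve K))
    rw [h1] at h2
    have h3 := (dvd_pow_self v.asIdeal
      (minimalDiscriminantExponent_mordellCurve_ne_zero hπ v hv)).trans h2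
    rw [Ideal.dvd_iff_le, top_le_iff] at h3
    exact v.isPrime.ne_top h3
  refine ⟨Real.log_pos (by exact_mod_cast (by omega : 1 < N)), ?_⟩
  refine Real.log_le_log (by exact_mod_cast hNpos) ?_
  exact_mod_cast Nat.le_of_dvd (by norm_num) hdvd

end Radical

/-- The height of an elliptic curve with vanishing `j`-invariant. -/
lemma faltingsHeight_of_j_eq_zero (E : WeierstrassCurve K) [E.IsElliptic] (hj : E.j = 0) :
    faltingsHeight E = hMin + 1 / (12 * (Module.finrank ℚ K : ℝ)) *
      Real.log (Ideal.absNorm (minimalDiscriminant E) : ℝ) := by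
  have hcard : (Fintype.card (K →+* ℂ) : ℝ) = Module.finrank ℚ K := by
    exact_mod_cast NumberField.Embeddings.card K ℂ
  have hpos : (0 : ℝ) < Module.finrank ℚ K := by exact_mod_cast Module.finrank_pos
  have hG1 : 0 < Real.Gamma (1 / 3) := Real.Gamma_pos_of_pos (by norm_num)
  have hG2 : 0 < Real.Gamma (2 / 3) := Real.Gamma_pos_of_pos (by norm_num)
  rw [faltingsHeight, hMin]
  simp only [hj, map_zero, norm_modularDelta_mul_im_pow_of_modularJ_eq_zero modularJ_tauOfJ_zero]
  rw [Finset.sum_const, Finset.card_univ, nsmul_eq_mul, hcard, Real.log_pow,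
    Real.log_mul Real.pi_ne_zero (by positivity)]
  field_simp
  push_cast
  ring

/-- The degree is odd, so it suffices that 6 is not a `p`-th power for any prime `p` dividing it;
its 2-adic valuation is 1. -/
lemma irreducible_X_pow_sub_C_six (m : ℕ) :
    Irreducible (Polynomial.X ^ (12 * m + 1) - Polynomial.C (6 : ℚ)) := by
  refine X_pow_sub_C_irreducible_of_odd ⟨6 * m, by ring⟩ fun p hp _ b hb => ?_
  have hb0 : b ≠ 0 := by
    rintro rfl
    rw [zero_pow hp.ne_zero] at hb
    norm_num at hb
  have h1 := congrArg (padicValRat 2) hb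
  rw [padicValRat.pow, show (6 : ℚ) = ((2 : ℕ) : ℚ) * ((3 : ℕ) : ℚ) by norm_num,
    padicValRat.mul (by norm_num) (by norm_num), padicValRat.of_nat, padicValRat.of_nat,
    padicValNat_self, padicValNat.eq_zero_of_not_dvd (by norm_num)] at h1
  have h2 : (p : ℤ) ∣ 1 := ⟨_, by simpa using h1.symm⟩
  exact hp.one_lt.ne' (by exact_mod_cast Int.eq_one_of_dvd_one (by positivity) h2)

lemma exists_numberField_pow_eq_six (m : ℕ) :
    ∃ (K : Type) (_ : Field K) (_ : NumberField K) (π : 𝓞 K),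
      π ^ (12 * m + 1) = 6 ∧ Module.finrank ℚ K = 12 * m + 1 := by
  have hirr := irreducible_X_pow_sub_C_six m
  have : Fact (Irreducible (Polynomial.X ^ (12 * m + 1) - Polynomial.C (6 : ℚ))) := ⟨hirr⟩
  set f := Polynomial.X ^ (12 * m + 1) - Polynomial.C (6 : ℚ) with hf
  let pb := AdjoinRoot.powerBasis hirr.ne_zero
  have hfin : FiniteDimensional ℚ (AdjoinRoot f) := pb.finite
  have hroot : AdjoinRoot.root f ^ (12 * m + 1) = 6 := by
    have h := AdjoinRoot.eval₂_root f
    simp only [hf, Polynomial.eval₂_sub, Polynomial.eval₂_pow, Polynomial.eval₂_X,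
      Polynomial.eval₂_C] at h
    rw [sub_eq_zero.1 h]
    simp
  have hint : IsIntegral ℤ (AdjoinRoot.root f) := by
    refine IsIntegral.of_pow (n := 12 * m + 1) (by omega) ?_
    rw [hroot]
    exact_mod_cast isIntegral_algebraMap (R := ℤ) (A := AdjoinRoot f) (x := 6)
  have hNF : NumberField (AdjoinRoot f) := NumberField.mk
  obtain ⟨π, hπ⟩ : ∃ π : 𝓞 (AdjoinRoot f), algebraMap (𝓞 (AdjoinRoot f)) (AdjoinRoot f) π =
      AdjoinRoot.root f := ⟨⟨_, hint⟩, rfl⟩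
  refine ⟨AdjoinRoot f, inferInstance, hNF, π, ?_, ?_⟩
  · apply NumberField.RingOfIntegers.coe_injective
    rw [map_pow, map_ofNat, hπ, hroot]
  · rw [pb.finrank, AdjoinRoot.powerBasis_dim, hf, Polynomial.natDegree_X_pow_sub_C]

end FaltingsGap

theorem mainTheorem2 :
    ∀ ε : ℝ, 0 < ε →
      ∃ (K : Type) (_ : Field K) (_ : NumberField K) (E : WeierstrassCurve K) (_ : E.IsElliptic),
        E.j = 0 ∧
          FaltingsGap.hMin < FaltingsGap.faltingsHeight E ∧
          FaltingsGap.faltingsHeight E < FaltingsGap.hMin + ε := by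
  intro ε hε
  obtain ⟨m, hm⟩ := exists_nat_gt (Real.log (6 ^ 4) / ε)
  obtain ⟨K, hF, hNF, π, hπ, hK⟩ := FaltingsGap.exists_numberField_pow_eq_six m
  have hheight := FaltingsGap.faltingsHeight_of_j_eq_zero (FaltingsGap.mordellCurve K)
    FaltingsGap.mordellCurve_j
  obtain ⟨h1, h2⟩ := FaltingsGap.log_absNorm_minimalDiscriminant_mordellCurve hπ hK
  have hd : (0 : ℝ) < 12 * (Module.finrank ℚ K : ℝ) := by rw [hK]; positivity
  refine ⟨K, hF, hNF, FaltingsGap.mordellCurve K, inferInstance, FaltingsGap.mordellCurve_j, ?_, ?_⟩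
  · rw [hheight]
    have := mul_pos (one_div_pos.2 hd) h1
    linarith
  · rw [hheight]
    refine add_lt_add_right (α := ℝ) ?_ _
    rw [div_lt_iff₀ hε] at hm
    rw [one_div, inv_mul_lt_iff₀ hd, hK]
    push_cast
    nlinarith [(Nat.cast_nonneg m : (0 : ℝ) ≤ m)]
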